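/- Let $d\ge 2$, let $\Omega\subseteq\mathbb R^d$ be a bounded convex open set, and let $a\colon\Omega\times\mathbb S^{d-1}\times[0,\infty)\to\mathbb C$ be $C^\infty$ (up to $t=0$) and compactly supported with respect to $t$, i.e. for all $x\in\Omega$, $\theta\in\mathbb S^{d-1}$ the function $t\mapsto a(x,\theta,t)$ vanishes for all large $t$. For $q\in C_c^\infty(\Omega)$ (extended by $0$ to $\mathbb R^d$) define $$P(q)(x)=\int_0^\infty\int_{\mathbb S^{d-1}}a(x,\theta,t)\,q(x-t\theta)\,d\theta\,dt ,\qquad x\in\Omega .$$ For $m\in\mathbb R$ let $S^m(\Omega\times\mathbb R^d)$ be the set of all $b\in C^\infty(\Omega\times\mathbb R^d)$ such that for every compact $K\subset\Omega$ and all multi-indices $\alpha,\beta$ there is a constant $C$ with $$|\partial_x^\beta\partial_\xi^\alpha b(x,\xi)|\le C(1+|\xi|)^{m-|\alpha|}\qquad(x\in K,\ \xi\in\mathbb R^d).$$ A linear operator $A\colon\mathcal E'(\Omega)\to\mathcal D'(\Omega)$ from compactly supported distributions to distributions has symbol $b$ if $$\langle Au,\varphi\rangle=(2\pi)^{-d}\int_{\mathbb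 R^d}\hat u(\xi)\int_\Omega \varphi(x)\,b(x,\xi)\,e^{i\langle x,\xi\rangle}\,dx\,d\xi\qquad (u\in\mathcal E'(\Omega),\ \varphi\in C_c^\infty(\Omega)),$$ where $\hat u(\xi)=\langle u,e^{-i\langle\cdot,\xi\rangle}\rangle$, and it is a pseudodifferential operator of order at most $m$ on $\Omega$ if it has a symbol in $S^m(\Omega\times\mathbb R^d)$. Then $P(q)$ is locally integrable on $\Omega$ for every $q\in C_c^\infty(\Omega)$, and $P$ extends to a pseudodifferential operator $A\colon\mathcal E'(\Omega)\to\mathcal D'(\Omega)$ of order at most $-1/2$ on $\Omega$. Moreover, if the support in $t$ is bounded locally uniformly in $x$ (for every compact $K\subset\Omega$ there is $T$ with $a(x,\theta,t)=0$ for all $x\in K$, $\theta\in\mathbb S^{d-1}$, $t\ge T$), then $$b(x,\xi)=\int_{\mathbb S^{d-1}}\int_0^\infty a(x,\theta,t)\,e^{-it\langle\theta,\xi\rangle}\,dt\,d\theta$$ belongs to $S^{-1/2}(\Omega\times\mathbb R^d)$, $A$ has symbol $b$, and for all $q\in C_c^\infty(\Omega)$ and $x\in\Omega$ $$P(q)(x)=(2\pi)^{-d}\int_{\mathbb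 R^d}\int_{\mathbb R^d} b(x,\xi)\,e^{i\langle x-y,\xi\rangle}\,q(y)\,dy\,d\xi ,$$ where the integral over $y$ is taken first. -/

import Mathlib

open scoped ContDiff Manifold Distributions Topology EuclideanSpace

noncomputable section

/-- Complex-valued distributions on the open set `Ω`: continuous `ℂ`-linear functionals on the
complex test functions, which carry their canonical LF topology. -/
abbrev CDistribution {d : ℕ} (Ω : TopologicalSpace.Opens (EuclideanSpace ℝ (Fin d))) : Type :=
  𝓓(Ω, ℂ) →L[ℂ] ℂ

/-- The plane wave `x ↦ exp (i ⟨x, ξ⟩)`. -/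
def planeWave {d : ℕ} (ξ x : EuclideanSpace ℝ (Fin d)) : ℂ :=
  Complex.exp (((inner ℝ x ξ : ℝ) : ℂ) * Complex.I)

theorem contDiff_planeWave {d : ℕ} (ξ : EuclideanSpace ℝ (Fin d)) :
    ContDiff ℝ ∞ (planeWave ξ) := by
  unfold planeWave
  have h : ContDiff ℝ ∞ fun x : EuclideanSpace ℝ (Fin d) => ((inner ℝ x ξ : ℝ) : ℂ) :=
    Complex.ofRealCLM.contDiff.comp (contDiff_id.inner ℝ contDiff_const)
  exact (h.mul contDiff_const).cexp

/-- The test function `y ↦ χ y * exp (-i ⟨y, ξ⟩)`. -/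
def cutoffWave {d : ℕ} {Ω : TopologicalSpace.Opens (EuclideanSpace ℝ (Fin d))}
    (χ : 𝓓(Ω, ℂ)) (ξ : EuclideanSpace ℝ (Fin d)) : 𝓓(Ω, ℂ) where
  toFun y := χ y * planeWave (-ξ) y
  contDiff' := χ.contDiff.mul (contDiff_planeWave (-ξ))
  hasCompactSupport' := χ.hasCompactSupport.mul_right
  tsupport_subset' := (tsupport_mul_subset_left).trans χ.tsupport_subset

/-- The space of compactly supported distributions on `Ω`. -/
def compactDist {d : ℕ} (Ω : TopologicalSpace.Opens (EuclideanSpace ℝ (Fin d))) :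
    Submodule ℂ (CDistribution Ω) where
  carrier := {u | ∃ K : Set (EuclideanSpace ℝ (Fin d)), IsCompact K ∧ K ⊆ Ω ∧
    Distribution.IsVanishingOn u Kᶜ}
  add_mem' := by
    rintro u v ⟨K, hK, hKΩ, hu⟩ ⟨L, hL, hLΩ, hv⟩
    refine ⟨K ∪ L, hK.union hL, Set.union_subset hKΩ hLΩ, fun φ hφ => ?_⟩
    rw [Set.compl_union] at hφ
    have h1 := hu φ (hφ.trans Set.inter_subset_left)
    have h2 := hv φ (hφ.trans Set.inter_subset_right)
    simp [h1, h2]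
  zero_mem' := ⟨∅, isCompact_empty, Set.empty_subset _, fun _ _ => rfl⟩
  smul_mem' := by
    rintro c u ⟨K, hK, hKΩ, hu⟩
    refine ⟨K, hK, hKΩ, fun φ hφ => ?_⟩
    have h1 := hu φ hφ
    simp [h1]

/-- The distribution `φ ↦ ∫ φ(x) f(x) dx` on `Ω` defined by a function `f` that is locally
integrable on `Ω`. -/
def functionDist {d : ℕ} (Ω : TopologicalSpace.Opens (EuclideanSpace ℝ (Fin d)))
    (f : EuclideanSpace ℝ (Fin d) → ℂ) : CDistribution Ω :=
  TestFunction.integralAgainstBilinCLM (ContinuousLinearMap.mul ℂ ℂ) MeasureTheory.volume f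

theorem functionDist_mem {d : ℕ} {Ω : TopologicalSpace.Opens (EuclideanSpace ℝ (Fin d))}
    (q : 𝓓(Ω, ℂ)) : functionDist Ω q ∈ compactDist Ω := by
  refine ⟨tsupport q, q.hasCompactSupport, q.tsupport_subset, fun φ hφ => ?_⟩
  have h : ∀ x, φ x * q x = 0 := fun x => by
    by_cases hx : x ∈ tsupport q
    · have : x ∉ tsupport φ := fun h' => hφ h' hx
      rw [image_eq_zero_of_notMem_tsupport this, zero_mul]
    · rw [image_eq_zero_of_notMem_tsupport hx, mul_zero]
  simp [functionDist, h]

/-- A test function viewed as a compactly supported distribution. -/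
def testDist {d : ℕ} {Ω : TopologicalSpace.Opens (EuclideanSpace ℝ (Fin d))}
    (q : 𝓓(Ω, ℂ)) : compactDist Ω :=
  ⟨functionDist Ω q, functionDist_mem q⟩

/-- The symbol class `S^m(Ω × ℝ^d)`: `b` is smooth on `Ω × ℝ^d`, and for every compact `K ⊆ Ω`
all derivatives of order `j` in `ξ` and order `k` in `x` are `O((1 + |ξ|)^(m - j))`, uniformly
for `x ∈ K`. -/
def IsSymbol {d : ℕ} (Ω : TopologicalSpace.Opens (EuclideanSpace ℝ (Fin d))) (m : ℝ)
    (b : EuclideanSpace ℝ (Fin d) → EuclideanSpace ℝ (Fin d) → ℂ) : Prop :=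
  ContDiffOn ℝ ∞ (fun p : EuclideanSpace ℝ (Fin d) × EuclideanSpace ℝ (Fin d) => b p.1 p.2)
    ((Ω : Set (EuclideanSpace ℝ (Fin d))) ×ˢ Set.univ) ∧
  ∀ K : Set (EuclideanSpace ℝ (Fin d)), IsCompact K → K ⊆ Ω → ∀ j k : ℕ,
    ∃ C : ℝ, ∀ x ∈ K, ∀ ξ : EuclideanSpace ℝ (Fin d),
      ‖iteratedFDeriv ℝ k (fun y => iteratedFDeriv ℝ j (b y) ξ) x‖
        ≤ C * (1 + ‖ξ‖) ^ (m - (j : ℝ))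

/-- `b(x, D) q (x) = (2π)^(-d) ∫ exp(i⟨x, ξ⟩) b(x, ξ) (∫ exp(-i⟨y, ξ⟩) q(y) dy) dξ`. -/
def symbolOp {d : ℕ} (b : EuclideanSpace ℝ (Fin d) → EuclideanSpace ℝ (Fin d) → ℂ)
    (q : EuclideanSpace ℝ (Fin d) → ℂ) (x : EuclideanSpace ℝ (Fin d)) : ℂ :=
  ((2 * (Real.pi : ℂ)) ^ d)⁻¹ *
    ∫ ξ : EuclideanSpace ℝ (Fin d), planeWave ξ x * b x ξ *
      ∫ y : EuclideanSpace ℝ (Fin d), planeWave (-ξ) y * q y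

/-- `A` is the operator `b(x, D)` from compactly supported distributions on `Ω` to distributions
on `Ω`:
`⟨A u, φ⟩ = (2π)^(-d) ∫ û(ξ) (∫ φ(x) b(x, ξ) exp(i⟨x, ξ⟩) dx) dξ`, where
`û(ξ) = ⟨u, exp(-i⟨·, ξ⟩)⟩` is evaluated by means of any test function `χ` which equals `1`
near a compact set that carries `u`. -/
def HasSymbol {d : ℕ} {Ω : TopologicalSpace.Opens (EuclideanSpace ℝ (Fin d))}
    (A : compactDist Ω →ₗ[ℂ] CDistribution Ω)
    (b : EuclideanSpace ℝ (Fin d) → EuclideanSpace ℝ (Fin d) → ℂ) : Prop :=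
  ∀ (u : compactDist Ω) (K : Set (EuclideanSpace ℝ (Fin d))) (χ : 𝓓(Ω, ℂ)),
    IsCompact K → Distribution.IsVanishingOn (u : CDistribution Ω) Kᶜ →
    (∀ᶠ y in 𝓝ˢ K, χ y = 1) →
    ∀ φ : 𝓓(Ω, ℂ), A u φ = ((2 * (Real.pi : ℂ)) ^ d)⁻¹ *
      ∫ ξ : EuclideanSpace ℝ (Fin d), (u : CDistribution Ω) (cutoffWave χ ξ) *
        ∫ x : EuclideanSpace ℝ (Fin d), φ x * b x ξ * planeWave ξ x

/-- `A` is a pseudodifferential operator of order at most `m` on `Ω`. -/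
def IsPseudodifferential {d : ℕ} {Ω : TopologicalSpace.Opens (EuclideanSpace ℝ (Fin d))}
    (m : ℝ) (A : compactDist Ω →ₗ[ℂ] CDistribution Ω) : Prop :=
  ∃ b : EuclideanSpace ℝ (Fin d) → EuclideanSpace ℝ (Fin d) → ℂ, IsSymbol Ω m b ∧ HasSymbol A b

/-- `P(q)(x) = ∫_0^∞ ∫_{S^{d-1}} a(x, θ, t) q(x - tθ) dθ dt`, with the surface measure `dθ`. -/
def rayOp {d : ℕ}
    (a : EuclideanSpace ℝ (Fin d) → Metric.sphere (0 : EuclideanSpace ℝ (Fin d)) 1 → ℝ → ℂ)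
    (q : EuclideanSpace ℝ (Fin d) → ℂ) (x : EuclideanSpace ℝ (Fin d)) : ℂ :=
  ∫ t in Set.Ioi (0 : ℝ), ∫ θ : Metric.sphere (0 : EuclideanSpace ℝ (Fin d)) 1,
    (a x θ t * q (x - t • (θ : EuclideanSpace ℝ (Fin d))))
      ∂(MeasureTheory.Measure.toSphere MeasureTheory.volume)

/-- `b(x, ξ) = ∫_{S^{d-1}} ∫_0^∞ a(x, θ, t) exp(-i t ⟨θ, ξ⟩) dt dθ`. -/
def raySymbol {d : ℕ}
    (a : EuclideanSpace ℝ (Fin d) → Metric.sphere (0 : EuclideanSpace ℝ (Fin d)) 1 → ℝ → ℂ)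
    (x ξ : EuclideanSpace ℝ (Fin d)) : ℂ :=
  ∫ θ : Metric.sphere (0 : EuclideanSpace ℝ (Fin d)) 1,
    (∫ t in Set.Ioi (0 : ℝ), a x θ t * planeWave (-ξ) (t • (θ : EuclideanSpace ℝ (Fin d))))
      ∂(MeasureTheory.Measure.toSphere MeasureTheory.volume)

end

/-! The symbol is a superposition of the exponentials `e^{-it⟨θ, ξ⟩}`, which are the symbols of the
translations `q ↦ q(· - tθ)`. So `P` has symbol `b`, by Fubini and Fourier inversion
(`rayOp_eq_symbolOp`). The main point is the symbol estimate for `b`.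

A fixed direction `θ` gives no decay where `⟨θ, ξ⟩ = 0`, so the radial integral is spread over a
full neighbourhood in `ℝ^d`. If `h(t) = 0` for `t ≥ S²`, the substitution `t = s²τ` gives `∫_0^∞
h(t) dt = ∫_0^S 2sτ h(s²τ) ds` for every `τ ≥ 1`. Averaging over `τ ∈ [1, 2]` with a smooth density
and writing `w = τθ` turns `b(x, ξ)` into `∫_0^S s ∫ e^{-is²⟨w, ξ⟩} G(x, s, w) dw ds`, where `G` is
smooth and supported in `1 ≤ |w| ≤ 2` (`raySymbol_eq_oscIntegral`).

Integration by parts in `w` shows that the inner integral is `O((1 + s²|ξ|)^{-N})` for all `N`.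
Since `s = (s²)^{1/2}`, the integrand in `s` is `O((1 + |ξ|)^{-1/2})` uniformly in `s`, and this is
the order `-1/2` (`IsAmplitude.norm_oscIntegral_le`). A derivative in `x` falls on `G`. A derivative
in `ξ` produces a factor `s²`, which is worth one more power of `1 + |ξ|`.

A symbol defines an operator on compactly supported distributions because `û` grows polynomially,
while `∫ φ(x) b(x, ξ) e^{i⟨x, ξ⟩} dx` decays rapidly (`IsSymbol.exists_hasSymbol`). If the support
in `t` is not locally uniformly bounded, `a` is cut off beyond the diameter of `Ω`. This leaves `P`
unchanged, as `x - tθ` has then left `Ω`. -/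

noncomputable section

open MeasureTheory Set

local notation "𝔼" d:max => EuclideanSpace ℝ (Fin d)

/-! ### Differentiation under the integral sign -/

section ParametricIntegral

variable {P Q V : Type} [NormedAddCommGroup P] [NormedSpace ℝ P]
  [NormedAddCommGroup V] [NormedSpace ℝ V]

theorem hasFDerivAt_setIntegral_of_continuousOn [LocallyCompactSpace P] [TopologicalSpace Q] [T2Space Q]
    [MeasurableSpace Q] [BorelSpace Q]
    [SecondCountableTopology Q] {μ : Measure Q} [IsFiniteMeasureOnCompacts μ]
    {L : Set Q} (hL : IsCompact L) {U : Set P} (hU : IsOpen U) {F : P → Q → V}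
    {F' : P → Q → P →L[ℝ] V} (hF : ContinuousOn (Function.uncurry F) (U ×ˢ L))
    (hF' : ContinuousOn (Function.uncurry F') (U ×ˢ L))
    (hd : ∀ p ∈ U, ∀ q ∈ L, HasFDerivAt (F · q) (F' p q) p) {p : P} (hp : p ∈ U) :
    HasFDerivAt (fun p => ∫ q in L, F p q ∂μ) (∫ q in L, F' p q ∂μ) p := by
  -- On the compact product `W × L` the derivative is bounded by one constant, which serves as the
  -- dominating function.
  obtain ⟨W, hW, hWU, hWc⟩ := local_compact_nhds (hU.mem_nhds hp)
  obtain ⟨C, hC⟩ := (hWc.prod hL).exists_bound_of_continuousOn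
    (hF'.mono (prod_mono hWU subset_rfl))
  have hslice : ∀ x ∈ U, ContinuousOn (F x) L := fun x hx =>
    hF.comp (f := fun q => (x, q)) (by fun_prop) fun q hq => ⟨hx, hq⟩
  have hslice' : ContinuousOn (F' p) L :=
    hF'.comp (f := fun q => (p, q)) (by fun_prop) fun q hq => ⟨hp, hq⟩
  refine hasFDerivAt_integral_of_dominated_of_fderiv_le (bound := fun _ => C) hW ?_ ?_ ?_ ?_ ?_ ?_
  · filter_upwards [hU.mem_nhds hp] with x hx
    exact (hslice x hx).aestronglyMeasurable_of_isCompact hL hL.measurableSet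
  · exact (hslice p hp).integrableOn_compact hL
  · exact hslice'.aestronglyMeasurable_of_isCompact hL hL.measurableSet
  · filter_upwards [ae_restrict_mem hL.measurableSet] with q hq x hx
    exact hC (x, q) ⟨hx, hq⟩
  · exact integrableOn_const hL.measure_ne_top
  · filter_upwards [ae_restrict_mem hL.measurableSet] with q hq x hx
    exact hd x (hWU hx) q hq

variable [NormedAddCommGroup Q] [NormedSpace ℝ Q]

theorem ContDiffOn.hasFDerivAt_left {U : Set P} (hU : IsOpen U) {F : P → Q → V} {n : WithTop ℕ∞}
    (hF : ContDiffOn ℝ n (Function.uncurry F) (U ×ˢ univ)) (hn : n ≠ 0) {p : P} (hp : p ∈ U)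
    (q : Q) : HasFDerivAt (F · q) ((fderiv ℝ (Function.uncurry F) (p, q)).comp
      (ContinuousLinearMap.inl ℝ P Q)) p := by
  have h := ((hF.contDiffAt ((hU.prod isOpen_univ).mem_nhds (x := (p, q)) ⟨hp, trivial⟩)).differentiableAt
    hn).hasFDerivAt
  exact h.comp (f := fun p => (p, q)) p (hasFDerivAt_prodMk_left p q)

theorem ContDiffOn.hasFDerivAt_right {U : Set P} (hU : IsOpen U) {F : P → Q → V} {n : WithTop ℕ∞}
    (hF : ContDiffOn ℝ n (Function.uncurry F) (U ×ˢ univ)) (hn : n ≠ 0) {p : P} (hp : p ∈ U)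
    (q : Q) : HasFDerivAt (F p) ((fderiv ℝ (Function.uncurry F) (p, q)).comp
      (ContinuousLinearMap.inr ℝ P Q)) q := by
  have h := ((hF.contDiffAt ((hU.prod isOpen_univ).mem_nhds (x := (p, q)) ⟨hp, trivial⟩)).differentiableAt
    hn).hasFDerivAt
  exact h.comp (f := fun q => (p, q)) q (hasFDerivAt_prodMk_right p q)

theorem ContDiffOn.uncurry_fderiv_left {U : Set P} (hU : IsOpen U) {F : P → Q → V}
    (hF : ContDiffOn ℝ ∞ (Function.uncurry F) (U ×ˢ univ)) :
    ContDiffOn ℝ ∞ (Function.uncurry fun p q => fderiv ℝ (F · q) p) (U ×ˢ univ) := by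
  have h := (contDiff_const (c := ((ContinuousLinearMap.compL ℝ P (P × Q) V).flip
    (ContinuousLinearMap.inl ℝ P Q)))).contDiffOn.clm_apply
    (hF.fderiv_of_isOpen (m := ∞) (hU.prod isOpen_univ) (by simp))
  refine h.congr fun p hp => ?_
  exact (hF.hasFDerivAt_left hU (by simp) hp.1 p.2).fderiv

theorem ContDiffOn.uncurry_fderiv_right {U : Set P} (hU : IsOpen U) {F : P → Q → V}
    (hF : ContDiffOn ℝ ∞ (Function.uncurry F) (U ×ˢ univ)) :
    ContDiffOn ℝ ∞ (Function.uncurry fun p q => fderiv ℝ (F p) q) (U ×ˢ univ) := by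
  have h := (contDiff_const (c := ((ContinuousLinearMap.compL ℝ Q (P × Q) V).flip
    (ContinuousLinearMap.inr ℝ P Q)))).contDiffOn.clm_apply
    (hF.fderiv_of_isOpen (m := ∞) (hU.prod isOpen_univ) (by simp))
  refine h.congr fun p hp => ?_
  exact (hF.hasFDerivAt_right hU (by simp) hp.1 p.2).fderiv

variable [LocallyCompactSpace P] [MeasurableSpace Q] [BorelSpace Q] [SecondCountableTopology Q] {μ : Measure Q}
  [IsFiniteMeasureOnCompacts μ]

theorem ContDiffOn.hasFDerivAt_setIntegral {L : Set Q} (hL : IsCompact L) {U : Set P}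
    (hU : IsOpen U) {F : P → Q → V}
    (hF : ContDiffOn ℝ ∞ (Function.uncurry F) (U ×ˢ univ)) {p : P} (hp : p ∈ U) :
    HasFDerivAt (fun p => ∫ q in L, F p q ∂μ) (∫ q in L, fderiv ℝ (F · q) p ∂μ) p := by
  refine hasFDerivAt_setIntegral_of_continuousOn (F' := fun p q => fderiv ℝ (F · q) p) hL hU
    (hF.continuousOn.mono (prod_mono subset_rfl (subset_univ _)))
    ((hF.uncurry_fderiv_left hU).continuousOn.mono (prod_mono subset_rfl (subset_univ _)))
    (fun x hx q _ => ?_) hp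
  exact (hF.hasFDerivAt_left hU (by simp) hx q).differentiableAt.hasFDerivAt

theorem ContDiffOn.setIntegral {L : Set Q} (hL : IsCompact L) {U : Set P} (hU : IsOpen U)
    {F : P → Q → V} (hF : ContDiffOn ℝ ∞ (Function.uncurry F) (U ×ˢ univ)) :
    ContDiffOn ℝ ∞ (fun p => ∫ q in L, F p q ∂μ) U := by
  rw [contDiffOn_infty]
  intro n
  -- The derivative in the parameter is an integral of the same kind with values in `P →L[ℝ] V`, so
  -- the target space has to vary in the induction.
  induction n generalizing V with
  | zero =>
    exact contDiffOn_zero.2 fun p hp =>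
      (hF.hasFDerivAt_setIntegral hL hU hp).continuousAt.continuousWithinAt
  | succ n ih =>
    rw [Nat.cast_succ, contDiffOn_succ_iff_fderiv_of_isOpen hU]
    refine ⟨fun p hp => (hF.hasFDerivAt_setIntegral hL hU hp).differentiableAt.differentiableWithinAt,
      by simp, ?_⟩
    exact (ih (hF.uncurry_fderiv_left hU)).congr fun p hp =>
      (hF.hasFDerivAt_setIntegral hL hU hp).fderiv

end ParametricIntegral

/-! ### Plane waves, amplitudes and non-stationary phase -/

section PlaneWave

variable {d : ℕ}

theorem norm_planeWave (ξ x : 𝔼 d) : ‖planeWave ξ x‖ = 1 :=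
  Complex.norm_exp_ofReal_mul_I _

theorem planeWave_smul (c : ℝ) (ξ x : 𝔼 d) : planeWave ξ (c • x) = planeWave (c • ξ) x := by
  simp [planeWave, inner_smul_left, inner_smul_right]

theorem planeWave_sub (ξ x y : 𝔼 d) :
    planeWave ξ (x - y) = planeWave ξ x * planeWave (-ξ) y := by
  simp only [planeWave, inner_sub_left, inner_neg_right]
  rw [← Complex.exp_add]
  push_cast
  ring_nf

theorem contDiff_uncurry_planeWave : ContDiff ℝ ∞ fun p : 𝔼 d × 𝔼 d => planeWave p.1 p.2 := by
  unfold planeWave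
  have h : ContDiff ℝ ∞ fun p : 𝔼 d × 𝔼 d => ((inner ℝ p.2 p.1 : ℝ) : ℂ) :=
    Complex.ofRealCLM.contDiff.comp (contDiff_snd.inner ℝ contDiff_fst)
  exact (h.mul contDiff_const).cexp

@[fun_prop]
theorem Continuous.planeWave {X : Type*} [TopologicalSpace X] {f g : X → 𝔼 d} (hf : Continuous f)
    (hg : Continuous g) : Continuous fun x => planeWave (f x) (g x) :=
  contDiff_uncurry_planeWave.continuous.comp (hf.prodMk hg)

theorem hasFDerivAt_planeWave (ξ x : 𝔼 d) :
    HasFDerivAt (planeWave ξ) ((innerSL ℝ ξ).smulRight (planeWave ξ x * Complex.I)) x := by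
  have h := (innerSL ℝ ξ).hasFDerivAt (x := x)
  have h2 := (((Complex.ofRealCLM.hasFDerivAt (x := inner ℝ ξ x)).comp x h).mul_const
    Complex.I).cexp
  have h3 : planeWave ξ = fun x => Complex.exp ((Complex.ofRealCLM (innerSL ℝ ξ x)) * Complex.I) := by
    ext x
    simp [planeWave, real_inner_comm]
  rw [h3]
  convert! h2 using 1
  ext v
  simp
  ring

variable {V : Type} [NormedAddCommGroup V] [NormedSpace ℝ V] [NormedSpace ℂ V]
  [IsScalarTower ℝ ℂ V]

/-- Integration by parts in the direction `η`: there the derivative of `e^{-i⟨w, η⟩}` is `-i|η|²`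
times itself, so the integral with `fderiv ℝ g`, applied to `η`, is `i|η|²` times the integral with
`g`. One factor `|η|` is lost to the operator norm. Vector values allow iteration with `fderiv ℝ g`
in place of `g`. -/
theorem norm_mul_norm_integral_planeWave_smul_le {g : 𝔼 d → V} (hg : ContDiff ℝ 1 g)
    (hc : HasCompactSupport g) (η : 𝔼 d) :
    ‖η‖ * ‖∫ w, planeWave (-η) w • g w‖ ≤ ‖∫ w, planeWave (-η) w • fderiv ℝ g w‖ := by
  have hg' : Continuous (fderiv ℝ g) := hg.continuous_fderiv one_ne_zero
  have hw : Continuous (planeWave (-η)) := (contDiff_planeWave _).continuous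
  have hint : Integrable fun w => planeWave (-η) w • fderiv ℝ g w :=
    (hw.smul hg').integrable_of_hasCompactSupport (hc.fderiv ℝ).smul_left
  have hfd : ∀ w, fderiv ℝ (planeWave (-η)) w η • g w
      = (-(‖η‖ ^ 2 : ℝ) * Complex.I : ℂ) • (planeWave (-η) w • g w) := fun w => by
    rw [(hasFDerivAt_planeWave _ _).fderiv, smul_smul]
    congr 1
    simp
    ring
  have hint0 : Integrable fun w => planeWave (-η) w • g w :=
    (hw.smul hg.continuous).integrable_of_hasCompactSupport hc.smul_left
  have key : (∫ w, planeWave (-η) w • fderiv ℝ g w) η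
      = ((‖η‖ ^ 2 : ℝ) * Complex.I : ℂ) • ∫ w, planeWave (-η) w • g w := by
    rw [ContinuousLinearMap.integral_apply hint]
    have := integral_smul_fderiv_eq_neg_fderiv_smul_of_integrable (μ := volume)
      (f := planeWave (-η)) (g := g) (v := η) ?_ ?_ hint0
      (fun x _ => (hasFDerivAt_planeWave _ _).differentiableAt)
      (fun x _ => (hg.differentiable one_ne_zero) x)
    · simp only [_root_.smul_apply]
      rw [this]
      simp_rw [hfd]
      rw [integral_smul, ← neg_smul]
      simp
    · simp_rw [hfd]
      exact hint0.smul _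
    · exact hint.apply_continuousLinearMap η
  rcases eq_or_ne η 0 with rfl | h0
  · simp
  have hpos : 0 < ‖η‖ := norm_pos_iff.2 h0
  have h1 := (∫ w, planeWave (-η) w • fderiv ℝ g w).le_opNorm η
  rw [key, norm_smul] at h1
  have h2 : ‖((‖η‖ ^ 2 : ℝ) * Complex.I : ℂ)‖ = ‖η‖ * ‖η‖ := by
    rw [norm_mul, Complex.norm_I, mul_one, Complex.norm_real]
    simp [sq]
  rw [h2] at h1
  refine le_of_mul_le_mul_right ?_ hpos
  linarith

end PlaneWave

section Amplitude

variable {d : ℕ}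

variable {V : Type} [NormedAddCommGroup V] [NormedSpace ℝ V]

/-- Smooth functions of `x ∈ Ω`, `s ∈ ℝ` and `w ∈ ℝ^d` that vanish for `|w| > 2`. -/
structure IsAmplitude (Ω : Set (EuclideanSpace ℝ (Fin d)))
    (G : EuclideanSpace ℝ (Fin d) → ℝ × EuclideanSpace ℝ (Fin d) → V) : Prop where
  contDiffOn : ContDiffOn ℝ ∞ (Function.uncurry G) (Ω ×ˢ univ)
  eq_zero : ∀ x ∈ Ω, ∀ s w, 2 < ‖w‖ → G x (s, w) = 0

namespace IsAmplitude

variable {Ω : Set (𝔼 d)} {G : 𝔼 d → ℝ × 𝔼 d → V}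

theorem fderiv_left (hΩ : IsOpen Ω) (hG : IsAmplitude Ω G) :
    IsAmplitude Ω fun x q => fderiv ℝ (G · q) x where
  contDiffOn := hG.contDiffOn.uncurry_fderiv_left hΩ
  eq_zero x hx s w hw := by
    have h : (G · (s, w)) =ᶠ[𝓝 x] fun _ => 0 := by
      filter_upwards [hΩ.mem_nhds hx] with y hy using hG.eq_zero y hy s w hw
    simpa using h.fderiv_eq (𝕜 := ℝ)

theorem contDiff_right (hG : IsAmplitude Ω G) {x : 𝔼 d} (hx : x ∈ Ω) : ContDiff ℝ ∞ (G x) := by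
  rw [← contDiffOn_univ]
  exact hG.contDiffOn.comp (f := fun q : ℝ × 𝔼 d => (x, q)) (contDiff_prodMk_right x).contDiffOn
    fun q _ => ⟨hx, trivial⟩

theorem contDiff_right_right (hG : IsAmplitude Ω G) {x : 𝔼 d} (hx : x ∈ Ω) (s : ℝ) :
    ContDiff ℝ ∞ fun w => G x (s, w) :=
  (hG.contDiff_right hx).comp (contDiff_prodMk_right s)

theorem hasCompactSupport (hG : IsAmplitude Ω G) {x : 𝔼 d} (hx : x ∈ Ω) (s : ℝ) :
    HasCompactSupport fun w => G x (s, w) :=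
  HasCompactSupport.intro (isCompact_closedBall 0 2) fun w hw => hG.eq_zero x hx s w (by
    simpa using hw)

theorem fderiv_right (hΩ : IsOpen Ω) (hG : IsAmplitude Ω G) :
    IsAmplitude Ω fun x q => fderiv ℝ (fun w => G x (q.1, w)) q.2 where
  contDiffOn := by
    have h := (contDiff_const (c := ((ContinuousLinearMap.compL ℝ (𝔼 d) (ℝ × 𝔼 d) V).flip
      (ContinuousLinearMap.inr ℝ ℝ (𝔼 d) )))).contDiffOn.clm_apply
      (hG.contDiffOn.uncurry_fderiv_right hΩ)
    refine h.congr fun p hp => ?_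
    have h1 := ((hG.contDiff_right hp.1).differentiable (by simp) (p.2.1, p.2.2)).hasFDerivAt
    exact (h1.comp (f := fun w => (p.2.1, w)) p.2.2 (hasFDerivAt_prodMk_right _ _)).fderiv
  eq_zero x hx s w hw := by
    have h : (fun w => G x (s, w)) =ᶠ[𝓝 w] fun _ => 0 := by
      filter_upwards [(isOpen_lt continuous_const continuous_norm).mem_nhds hw] with y hy
        using hG.eq_zero x hx s y hy
    simpa using h.fderiv_eq (𝕜 := ℝ)

variable [NormedSpace ℂ V] [IsScalarTower ℝ ℂ V]

/-- Multiplication by `-i ⟨w, ·⟩`. -/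
theorem inner_smul (hG : IsAmplitude Ω G) :
    IsAmplitude Ω fun x q => (innerSL ℝ q.2).smulRight ((-Complex.I) • G x q) where
  contDiffOn := by
    have h1 : ContDiffOn ℝ ∞ (fun p : 𝔼 d × (ℝ × 𝔼 d) => (-Complex.I) • G p.1 p.2) (Ω ×ˢ univ) :=
      hG.contDiffOn.const_smul _
    have h2 : ContDiff ℝ ∞ (fun p : 𝔼 d × (ℝ × 𝔼 d) =>
        ContinuousLinearMap.smulRightL ℝ (𝔼 d) V (innerSL ℝ p.2.2)) :=
      (ContinuousLinearMap.contDiff _).comp ((innerSL ℝ).contDiff.comp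
        (contDiff_snd.comp contDiff_snd))
    exact h2.contDiffOn.clm_apply h1
  eq_zero x hx s w hw := by
    simp [hG.eq_zero x hx s w hw]

/-- Each power of `1 + |η|` costs one derivative in `w`, and that derivative is again an amplitude,
with values in another space. For `N = 0` the bound is the supremum of `G` on a compact set times
the volume of the ball. -/
theorem integral_planeWave_decay (hΩ : IsOpen Ω) (hG : IsAmplitude Ω G) (N : ℕ) {K : Set (𝔼 d)}
    (hK : IsCompact K) (hKΩ : K ⊆ Ω) (S : ℝ) :
    ∃ C : ℝ, ∀ x ∈ K, ∀ s ∈ Icc 0 S, ∀ η : 𝔼 d,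
      (1 + ‖η‖) ^ N * ‖∫ w, planeWave (-η) w • G x (s, w)‖ ≤ C := by
  induction N generalizing V with
  | zero =>
    obtain ⟨C, hC⟩ := (hK.prod (isCompact_Icc.prod (isCompact_closedBall 0 2))).exists_bound_of_continuousOn
      (hG.contDiffOn.continuousOn.mono
      (prod_mono hKΩ (subset_univ (Icc 0 S ×ˢ Metric.closedBall (0 : 𝔼 d) 2))))
    refine ⟨C * volume.real (Metric.closedBall (0 : 𝔼 d) 2), fun x hx s hs η => ?_⟩
    rw [pow_zero, one_mul, ← setIntegral_eq_integral_of_forall_compl_eq_zero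
      (s := Metric.closedBall (0 : 𝔼 d) 2)]
    · refine norm_setIntegral_le_of_norm_le_const (isCompact_closedBall _ _).measure_lt_top
        fun w hw => ?_
      rw [norm_smul, norm_planeWave, one_mul]
      exact hC (x, s, w) ⟨hx, hs, hw⟩
    · intro w hw
      rw [hG.eq_zero x (hKΩ hx) s w (by simpa using hw), smul_zero]
  | succ N ih =>
    obtain ⟨C₁, h₁⟩ := ih hG
    obtain ⟨C₂, h₂⟩ := ih (hG.fderiv_right hΩ)
    refine ⟨C₁ + C₂, fun x hx s hs η => ?_⟩
    have h := norm_mul_norm_integral_planeWave_smul_le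
      ((hG.contDiff_right_right (hKΩ hx) s).of_le (by simp)) (hG.hasCompactSupport (hKΩ hx) s) η
    calc _ = (1 + ‖η‖) ^ N * ‖∫ w, planeWave (-η) w • G x (s, w)‖
          + (1 + ‖η‖) ^ N * (‖η‖ * ‖∫ w, planeWave (-η) w • G x (s, w)‖) := by ring
      _ ≤ _ := add_le_add (h₁ x hx s hs η)
        ((mul_le_mul_of_nonneg_left h (by positivity)).trans (h₂ x hx s hs η))

end IsAmplitude

end Amplitude

/-! ### Oscillatory integrals and their symbol estimates -/

section IteratedFDeriv

variable {X E V : Type} [NormedAddCommGroup X] [NormedSpace ℝ X] [NormedAddCommGroup E]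
  [NormedSpace ℝ E] [NormedAddCommGroup V] [NormedSpace ℝ V]

theorem norm_iteratedFDeriv_iteratedFDeriv_zero (b : X → E → V) (k : ℕ) (x : X) (ξ : E) :
    ‖iteratedFDeriv ℝ k (fun y => iteratedFDeriv ℝ 0 (b y) ξ) x‖
      = ‖iteratedFDeriv ℝ k (fun y => b y ξ) x‖ :=
  LinearIsometryEquiv.norm_iteratedFDeriv_comp_left
    (continuousMultilinearCurryFin0 ℝ E V).symm (fun y => b y ξ) x k

/-- The isometry between `j + 1`-linear maps and `j`-linear maps with values in linear maps. -/
def uncurryRightIsometry (j : ℕ) : (E [×j]→L[ℝ] E →L[ℝ] V) ≃ₗᵢ[ℝ] (E [×(j + 1)]→L[ℝ] V) :=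
  (continuousMultilinearCurryRightEquiv' ℝ j E V).symm

theorem norm_iteratedFDeriv_isometry_comp {F G : Type} [NormedAddCommGroup F] [NormedSpace ℝ F]
    [NormedAddCommGroup G] [NormedSpace ℝ G] (g : F ≃ₗᵢ[ℝ] G) (f : X → F) (h : X → G) (x : X)
    (k : ℕ) (hh : h =ᶠ[𝓝 x] fun y => g (f y)) :
    ‖iteratedFDeriv ℝ k h x‖ = ‖iteratedFDeriv ℝ k f x‖ := by
  rw [(hh.iteratedFDeriv ℝ k).eq_of_nhds]
  exact LinearIsometryEquiv.norm_iteratedFDeriv_comp_left g f x k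

/-- Splits off the innermost `ξ`-derivative. Currying is a linear isometry and therefore does not
affect norms of `x`-derivatives. The first derivative only needs to be known near `x`. -/
theorem norm_iteratedFDeriv_iteratedFDeriv_succ {b : X → E → V} {b' : X → E → E →L[ℝ] V} {x : X}
    (h : ∀ᶠ y in 𝓝 x, fderiv ℝ (b y) = b' y) (j k : ℕ) (ξ : E) :
    ‖iteratedFDeriv ℝ k (fun y => iteratedFDeriv ℝ (j + 1) (b y) ξ) x‖
      = ‖iteratedFDeriv ℝ k (fun y => iteratedFDeriv ℝ j (b' y) ξ) x‖ := by
  refine norm_iteratedFDeriv_isometry_comp (uncurryRightIsometry j) _ _ x k ?_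
  filter_upwards [h] with y hy
  rw [iteratedFDeriv_succ_eq_comp_right, Function.comp_apply, ← hy]
  rfl

end IteratedFDeriv

section Oscillatory

variable {d : ℕ} {V : Type} [NormedAddCommGroup V] [NormedSpace ℝ V] [NormedSpace ℂ V]

/-- The integrand `s^(2j+1) e^{-i s² ⟨w, ξ⟩} G(x, s, w)`. -/
def oscIntegrand (G : 𝔼 d → ℝ × 𝔼 d → V) (j : ℕ) (x ξ : 𝔼 d) (q : ℝ × 𝔼 d) : V :=
  (q.1 ^ (2 * j + 1)) • (planeWave (-ξ) (q.1 ^ 2 • q.2) • G x q)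

/-- The oscillatory integral `∫_0^S s^(2j+1) ∫ e^{-i s² ⟨w, ξ⟩} G(x, s, w) dw ds`. -/
def oscIntegral (G : 𝔼 d → ℝ × 𝔼 d → V) (j : ℕ) (S : ℝ) (x ξ : 𝔼 d) : V :=
  ∫ q in Icc (0 : ℝ) S ×ˢ Metric.closedBall (0 : 𝔼 d) 2, oscIntegrand G j x ξ q

theorem isCompact_Icc_prod_closedBall (S : ℝ) :
    IsCompact (Icc (0 : ℝ) S ×ˢ Metric.closedBall (0 : 𝔼 d) 2) :=
  isCompact_Icc.prod (isCompact_closedBall 0 2)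

variable [IsScalarTower ℝ ℂ V]

namespace IsAmplitude

variable {Ω : Set (𝔼 d)} {G : 𝔼 d → ℝ × 𝔼 d → V}

theorem contDiffOn_oscIntegrand (hG : IsAmplitude Ω G) (j : ℕ) :
    ContDiffOn ℝ ∞ (Function.uncurry fun (p : 𝔼 d × 𝔼 d) q => oscIntegrand G j p.1 p.2 q)
      ((Ω ×ˢ univ) ×ˢ univ) := by
  have h1 : ContDiff ℝ ∞ fun p : (𝔼 d × 𝔼 d) × ℝ × 𝔼 d => p.2.1 ^ (2 * j + 1) := by fun_prop
  have h2 : ContDiff ℝ ∞ fun p : (𝔼 d × 𝔼 d) × ℝ × 𝔼 d =>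
      planeWave (-p.1.2) (p.2.1 ^ 2 • p.2.2) :=
    contDiff_uncurry_planeWave.comp (f := fun p : (𝔼 d × 𝔼 d) × ℝ × 𝔼 d =>
      (-p.1.2, p.2.1 ^ 2 • p.2.2)) (by fun_prop)
  have h3 : ContDiffOn ℝ ∞ (fun p : (𝔼 d × 𝔼 d) × ℝ × 𝔼 d => G p.1.1 p.2)
      ((Ω ×ˢ univ) ×ˢ univ) :=
    hG.contDiffOn.comp (f := fun p : (𝔼 d × 𝔼 d) × ℝ × 𝔼 d => (p.1.1, p.2))
      (by fun_prop) fun p hp => ⟨hp.1.1, trivial⟩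
  exact h1.contDiffOn.smul (h2.contDiffOn.smul h3)

theorem contDiffOn_oscIntegral (hΩ : IsOpen Ω) (hG : IsAmplitude Ω G) (j : ℕ) (S : ℝ) :
    ContDiffOn ℝ ∞ (fun p : 𝔼 d × 𝔼 d => oscIntegral G j S p.1 p.2) (Ω ×ˢ univ) :=
  (hG.contDiffOn_oscIntegrand j).setIntegral (isCompact_Icc_prod_closedBall S)
    (hΩ.prod isOpen_univ)

theorem hasFDerivAt_oscIntegral_left (hΩ : IsOpen Ω) (hG : IsAmplitude Ω G) (j : ℕ) (S : ℝ)
    {x : 𝔼 d} (hx : x ∈ Ω) (ξ : 𝔼 d) :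
    HasFDerivAt (fun y => oscIntegral G j S y ξ)
      (oscIntegral (fun x q => _root_.fderiv ℝ (G · q) x) j S x ξ) x := by
  have h : ContDiffOn ℝ ∞ (Function.uncurry fun (y : 𝔼 d) q => oscIntegrand G j y ξ q)
      (Ω ×ˢ univ) :=
    (hG.contDiffOn_oscIntegrand j).comp (f := fun p : 𝔼 d × ℝ × 𝔼 d => ((p.1, ξ), p.2))
      (by fun_prop) fun p hp => ⟨⟨hp.1, trivial⟩, trivial⟩
  have h1 := h.hasFDerivAt_setIntegral (μ := volume) (isCompact_Icc_prod_closedBall S) hΩ hx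
  have h2 : ∀ q, _root_.fderiv ℝ (fun y => oscIntegrand G j y ξ q) x
      = oscIntegrand (fun x q => _root_.fderiv ℝ (G · q) x) j x ξ q := fun q => by
    have h3 := (hG.contDiffOn.hasFDerivAt_left hΩ (by simp) hx q).differentiableAt.hasFDerivAt
    exact ((h3.const_smul (planeWave (-ξ) (q.1 ^ 2 • q.2))).const_smul
      (q.1 ^ (2 * j + 1))).fderiv
  simp_rw [h2] at h1
  exact h1

theorem hasFDerivAt_oscIntegral_right (hG : IsAmplitude Ω G) (j : ℕ) (S : ℝ)
    {x : 𝔼 d} (hx : x ∈ Ω) (ξ : 𝔼 d) :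
    HasFDerivAt (oscIntegral G j S x)
      (oscIntegral (fun x q => (innerSL ℝ q.2).smulRight ((-Complex.I) • G x q)) (j + 1) S x ξ)
      ξ := by
  have h : ContDiffOn ℝ ∞ (Function.uncurry fun (ξ : 𝔼 d) q => oscIntegrand G j x ξ q)
      (univ ×ˢ univ) :=
    (hG.contDiffOn_oscIntegrand j).comp (f := fun p : 𝔼 d × ℝ × 𝔼 d => ((x, p.1), p.2))
      (by fun_prop) fun p _ => ⟨⟨hx, trivial⟩, trivial⟩
  have h1 := h.hasFDerivAt_setIntegral (μ := volume) (isCompact_Icc_prod_closedBall S)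
    isOpen_univ (mem_univ ξ)
  have h2 : ∀ q, _root_.fderiv ℝ (fun ξ => oscIntegrand G j x ξ q) ξ
      = oscIntegrand (fun x q => (innerSL ℝ q.2).smulRight ((-Complex.I) • G x q)) (j + 1) x ξ q :=
      fun q => by
    have h3 : HasFDerivAt (fun ξ : 𝔼 d => planeWave (-ξ) (q.1 ^ 2 • q.2))
        ((innerSL ℝ (-(q.1 ^ 2 • q.2))).smulRight
          (planeWave (-(q.1 ^ 2 • q.2)) ξ * Complex.I)) ξ := by
      refine (hasFDerivAt_planeWave (-(q.1 ^ 2 • q.2)) ξ).congr_of_eventuallyEq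
        (Filter.Eventually.of_forall fun ξ => ?_)
      simp [planeWave, real_inner_comm]
    have h4 := ((h3.smul_const (G x q)).const_smul (q.1 ^ (2 * j + 1))).fderiv
    refine h4.trans ?_
    have h5 : planeWave (-ξ) (q.1 ^ 2 • q.2) = planeWave (-(q.1 ^ 2 • q.2)) ξ := by
      simp [planeWave, real_inner_comm]
    ext v
    simp only [oscIntegrand, h5, _root_.smul_apply, ContinuousLinearMap.smulRight_apply,
      innerSL_apply_apply, inner_neg_left, inner_smul_left]
    have hre : ∀ (r : ℝ) (u : V), r • u = (r : ℂ) • u := fun r u => (algebraMap_smul ℂ r u).symm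
    simp only [hre, smul_smul, Complex.real_smul]
    congr 1
    push_cast
    simp
    ring
  simp_rw [h2] at h1
  exact h1

/-- Here the exponent `-1/2` arises. The integral over `w` is a transform at `η = s²ξ`, and the
weight is `s^(2j+1) = (s²)^(j+1/2)`. The decay in `s²|ξ|` turns this weight into `(1 +
|ξ|)^(-(j+1/2))` for each `s` separately, so the integration over `s` only contributes the length of
the interval. -/
theorem norm_oscIntegral_le (hΩ : IsOpen Ω) (hG : IsAmplitude Ω G) (j : ℕ) {S : ℝ}
    {K : Set (𝔼 d)} (hK : IsCompact K) (hKΩ : K ⊆ Ω) :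
    ∃ C : ℝ, ∀ x ∈ K, ∀ ξ : 𝔼 d,
      ‖oscIntegral G j S x ξ‖ ≤ C * (1 + ‖ξ‖) ^ (-1 / 2 - (j : ℝ)) := by
  -- Any integer power that is at least `j + 1/2` would do.
  obtain ⟨C, hC⟩ := hG.integral_planeWave_decay hΩ (j + 1) hK hKΩ S
  -- `M` is chosen so that `s²(1 + |ξ|) ≤ M(1 + s²|ξ|)` for `0 ≤ s ≤ S`: `S²` controls the first
  -- summand and `1` the second.
  set M : ℝ := max 1 (S ^ 2) with hM
  have hM0 : 0 ≤ M := by positivity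
  refine ⟨M ^ ((j : ℝ) + 1 / 2) * |C| * volume.real (Icc (0 : ℝ) S), fun x hx ξ => ?_⟩
  have hcont : Continuous (oscIntegrand G j x ξ) := by
    have h := (hG.contDiff_right (hKΩ hx)).continuous
    unfold oscIntegrand
    exact (by fun_prop : Continuous fun q : ℝ × 𝔼 d => q.1 ^ (2 * j + 1)).smul
      ((by fun_prop : Continuous fun q : ℝ × 𝔼 d => planeWave (-ξ) (q.1 ^ 2 • q.2)).smul h)
  have hb : ∀ s ∈ Icc (0 : ℝ) S,
      ‖∫ w in Metric.closedBall (0 : 𝔼 d) 2, oscIntegrand G j x ξ (s, w)‖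
        ≤ M ^ ((j : ℝ) + 1 / 2) * |C| * (1 + ‖ξ‖) ^ (-1 / 2 - (j : ℝ)) := fun s hs => by
    have h1 : ∫ w in Metric.closedBall (0 : 𝔼 d) 2, oscIntegrand G j x ξ (s, w)
        = (s ^ (2 * j + 1)) • ∫ w, planeWave (-(s ^ 2 • ξ)) w • G x (s, w) := by
      rw [setIntegral_eq_integral_of_forall_compl_eq_zero, ← integral_smul]
      · simp only [oscIntegrand, planeWave_smul, smul_neg]
      · intro w hw
        rw [oscIntegrand, hG.eq_zero x (hKΩ hx) s w (by simpa using hw), smul_zero, smul_zero]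
    have h2 := hC x hx s hs (s ^ 2 • ξ)
    rw [h1, norm_smul, norm_pow, Real.norm_of_nonneg hs.1]
    set R := ‖ξ‖
    have hR : 0 ≤ R := norm_nonneg _
    have h3 : ‖s ^ 2 • ξ‖ = s ^ 2 * R := by rw [norm_smul, norm_pow, Real.norm_of_nonneg hs.1]
    rw [h3] at h2
    set I := ‖∫ w, planeWave (-(s ^ 2 • ξ)) w • G x (s, w)‖
    have hI : 0 ≤ I := norm_nonneg _
    have h1R : 1 ≤ 1 + s ^ 2 * R := le_add_of_nonneg_right (by positivity)
    have h4 : (1 + s ^ 2 * R) ^ ((j : ℝ) + 1 / 2) * I ≤ |C| := by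
      refine (mul_le_mul_of_nonneg_right ?_ hI).trans (h2.trans (le_abs_self C))
      rw [← Real.rpow_natCast (1 + s ^ 2 * R) (j + 1)]
      exact Real.rpow_le_rpow_of_exponent_le h1R (by push_cast; linarith)
    have h5 : s ^ 2 * (1 + R) ≤ M * (1 + s ^ 2 * R) := by
      have e1 : s ^ 2 ≤ M := (pow_le_pow_left₀ hs.1 hs.2 2).trans (le_max_right _ _)
      have e2 : s ^ 2 * R ≤ M * (s ^ 2 * R) :=
        le_mul_of_one_le_left (by positivity) (le_max_left _ _)
      linarith
    have h6 : s ^ (2 * j + 1) * (1 + R) ^ ((j : ℝ) + 1 / 2)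
        ≤ M ^ ((j : ℝ) + 1 / 2) * (1 + s ^ 2 * R) ^ ((j : ℝ) + 1 / 2) := by
      have e : s ^ (2 * j + 1) = (s ^ 2) ^ ((j : ℝ) + 1 / 2) := by
        rw [← Real.rpow_natCast, ← Real.rpow_natCast, ← Real.rpow_mul hs.1]
        congr 1
        push_cast
        ring
      rw [e, ← Real.mul_rpow (by positivity) (by positivity),
        ← Real.mul_rpow hM0 (by positivity)]
      exact Real.rpow_le_rpow (by positivity) h5 (by positivity)
    rw [show (-1 / 2 - (j : ℝ)) = -((j : ℝ) + 1 / 2) by ring, Real.rpow_neg (by positivity),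
      ← div_eq_mul_inv, le_div_iff₀ (by positivity)]
    calc s ^ (2 * j + 1) * I * (1 + R) ^ ((j : ℝ) + 1 / 2)
        = s ^ (2 * j + 1) * (1 + R) ^ ((j : ℝ) + 1 / 2) * I := by ring
      _ ≤ M ^ ((j : ℝ) + 1 / 2) * (1 + s ^ 2 * R) ^ ((j : ℝ) + 1 / 2) * I := by gcongr
      _ = M ^ ((j : ℝ) + 1 / 2) * ((1 + s ^ 2 * R) ^ ((j : ℝ) + 1 / 2) * I) := by ring
      _ ≤ _ := by gcongr
  rw [oscIntegral, Measure.volume_eq_prod, setIntegral_prod _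
    (hcont.continuousOn.integrableOn_compact (isCompact_Icc_prod_closedBall S))]
  refine (norm_setIntegral_le_of_norm_le_const isCompact_Icc.measure_lt_top hb).trans
    (le_of_eq ?_)
  ring

theorem norm_iteratedFDeriv_left_oscIntegral_le (hΩ : IsOpen Ω) (hG : IsAmplitude Ω G) (j : ℕ)
    {S : ℝ} {K : Set (𝔼 d)} (hK : IsCompact K) (hKΩ : K ⊆ Ω) (k : ℕ) :
    ∃ C : ℝ, ∀ x ∈ K, ∀ ξ : 𝔼 d,
      ‖iteratedFDeriv ℝ k (fun y => oscIntegral G j S y ξ) x‖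
        ≤ C * (1 + ‖ξ‖) ^ (-1 / 2 - (j : ℝ)) := by
  induction k generalizing V with
  | zero => simpa using hG.norm_oscIntegral_le hΩ j hK hKΩ
  | succ k ih =>
    obtain ⟨C, hC⟩ := ih (hG.fderiv_left hΩ)
    refine ⟨C, fun x hx ξ => ?_⟩
    rw [← norm_iteratedFDeriv_fderiv]
    have h : _root_.fderiv ℝ (fun y => oscIntegral G j S y ξ) =ᶠ[𝓝 x]
        fun y => oscIntegral (fun x q => _root_.fderiv ℝ (G · q) x) j S y ξ := by
      filter_upwards [hΩ.mem_nhds (hKΩ hx)] with y hy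
        using (hG.hasFDerivAt_oscIntegral_left hΩ j S hy ξ).fderiv
    rw [(h.iteratedFDeriv ℝ k).eq_of_nhds]
    exact hC x hx ξ

/-- Differentiating `e^{-is²⟨w, ξ⟩}` in `ξ` gives `-is²⟨w, ·⟩`. The factor `s²` raises the index `m`
by one and the rest is absorbed into the amplitude, so the induction on `j` moves `m` and `V` along.
-/
theorem norm_iteratedFDeriv_oscIntegral_le (hΩ : IsOpen Ω) (hG : IsAmplitude Ω G) (m : ℕ)
    {S : ℝ} {K : Set (𝔼 d)} (hK : IsCompact K) (hKΩ : K ⊆ Ω) (j k : ℕ) :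
    ∃ C : ℝ, ∀ x ∈ K, ∀ ξ : 𝔼 d,
      ‖iteratedFDeriv ℝ k (fun y => iteratedFDeriv ℝ j (oscIntegral G m S y) ξ) x‖
        ≤ C * (1 + ‖ξ‖) ^ (-1 / 2 - ((m + j : ℕ) : ℝ)) := by
  induction j generalizing V m with
  | zero =>
    obtain ⟨C, hC⟩ := hG.norm_iteratedFDeriv_left_oscIntegral_le hΩ m (S := S) hK hKΩ k
    refine ⟨C, fun x hx ξ => le_of_eq_of_le ?_ (hC x hx ξ)⟩
    exact norm_iteratedFDeriv_iteratedFDeriv_zero _ k x ξ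
  | succ j ih =>
    obtain ⟨C, hC⟩ := ih hG.inner_smul (m + 1)
    refine ⟨C, fun x hx ξ => ?_⟩
    rw [show m + (j + 1) = m + 1 + j by ring]
    refine le_of_eq_of_le (norm_iteratedFDeriv_iteratedFDeriv_succ ?_ j k ξ) (hC x hx ξ)
    filter_upwards [hΩ.mem_nhds (hKΩ hx)] with y hy
    ext1 ξ'
    exact (hG.hasFDerivAt_oscIntegral_right m S hy ξ').fderiv

end IsAmplitude

end Oscillatory

section Symbol

variable {d : ℕ} {Ω : TopologicalSpace.Opens (𝔼 d)}

theorem IsAmplitude.isSymbol_oscIntegral {G : 𝔼 d → ℝ × 𝔼 d → ℂ}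
    (hG : IsAmplitude (Ω : Set (𝔼 d)) G) (S : ℝ) :
    IsSymbol Ω (-1 / 2) (oscIntegral G 0 S) := by
  refine ⟨hG.contDiffOn_oscIntegral Ω.isOpen 0 S, fun K hK hKΩ j k => ?_⟩
  simpa using hG.norm_iteratedFDeriv_oscIntegral_le Ω.isOpen 0 (S := S) hK hKΩ j k

/-- Being a symbol is a local property. -/
theorem isSymbol_of_local {m : ℝ} {b : 𝔼 d → 𝔼 d → ℂ}
    (h : ∀ K : Set (𝔼 d), IsCompact K → K ⊆ Ω → ∃ b' : 𝔼 d → 𝔼 d → ℂ, IsSymbol Ω m b' ∧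
      ∀ᶠ x in 𝓝ˢ K, b x = b' x) : IsSymbol Ω m b := by
  refine ⟨fun p hp => ?_, fun K hK hKΩ j k => ?_⟩
  · obtain ⟨b', hb', he⟩ := h {p.1} isCompact_singleton (by simpa using hp.1)
    rw [nhdsSet_singleton] at he
    refine (hb'.1 p hp).congr_of_eventuallyEq ?_ (by rw [he.self_of_nhds])
    refine Filter.Eventually.filter_mono nhdsWithin_le_nhds ?_
    filter_upwards [continuous_fst.continuousAt.eventually he] with q hq
    rw [hq]
  · obtain ⟨b', hb', he⟩ := h K hK hKΩ
    obtain ⟨C, hC⟩ := hb'.2 K hK hKΩ j k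
    refine ⟨C, fun x hx ξ => ?_⟩
    have h1 : (fun y => iteratedFDeriv ℝ j (b y) ξ) =ᶠ[𝓝 x]
        fun y => iteratedFDeriv ℝ j (b' y) ξ := by
      filter_upwards [he.filter_mono (nhds_le_nhdsSet hx)] with y hy
      rw [hy]
    rw [(h1.iteratedFDeriv ℝ k).eq_of_nhds]
    exact hC x hx ξ

end Symbol

/-! ### Polar coordinates and averaging over dilations -/

section Polar

theorem integral_eq_integral_sphere_integral_Ioi {n : ℕ} {f : 𝔼 (n + 1) → ℂ}
    (hf : Integrable f) :
    ∫ x, f x = ∫ θ : Metric.sphere (0 : 𝔼 (n + 1)) 1, (∫ τ in Ioi (0 : ℝ),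
      (τ ^ n) • f (τ • (θ : 𝔼 (n + 1)))) ∂(Measure.toSphere volume) := by
  set e := homeomorphUnitSphereProd (𝔼 (n + 1))
  have hdim : Module.finrank ℝ (𝔼 (n + 1)) - 1 = n := by simp
  have hmp := (volume : Measure (𝔼 (n + 1))).measurePreserving_homeomorphUnitSphereProd
  rw [hdim] at hmp
  set g : Metric.sphere (0 : 𝔼 (n + 1)) 1 × Ioi (0 : ℝ) → ℂ := fun p => f (e.symm p) with hg
  have hcomp : ∀ x : ({0}ᶜ : Set (𝔼 (n + 1))), g (e x) = f x := fun x => by simp [hg]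
  have hint : Integrable g ((Measure.toSphere volume).prod (Measure.volumeIoiPow n)) := by
    rw [← hmp.integrable_comp_emb e.measurableEmbedding]
    refine Integrable.congr (f := fun x : ({0}ᶜ : Set (𝔼 (n + 1))) => f x) ?_
      (.of_forall fun x => (hcomp x).symm)
    exact (integrableOn_iff_comap_subtypeVal (measurableSet_singleton _).compl).1 hf.integrableOn
  calc ∫ x, f x = ∫ x : ({0}ᶜ : Set (𝔼 (n + 1))), f x ∂(Measure.comap Subtype.val volume) := by
        rw [integral_subtype_comap (measurableSet_singleton _).compl f, restrict_compl_singleton]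
    _ = ∫ p, g p ∂((Measure.toSphere volume).prod (Measure.volumeIoiPow n)) := by
        rw [← hmp.integral_comp e.measurableEmbedding]
        exact integral_congr_ae (.of_forall fun x => (hcomp x).symm)
    _ = _ := by
        rw [integral_prod _ hint]
        refine integral_congr_ae (.of_forall fun θ => ?_)
        have hg' : ∀ r : Ioi (0 : ℝ), g (θ, r) = f (r.1 • (θ : 𝔼 (n + 1))) := fun r => by
          simp [hg, e]
        refine (integral_congr_ae (.of_forall hg')).trans ?_
        have hvol : Measure.volumeIoiPow n = (Measure.comap Subtype.val volume).withDensity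
            fun r : Ioi (0 : ℝ) => (Real.toNNReal (r.1 ^ n) : ENNReal) := rfl
        rw [hvol, integral_withDensity_eq_integral_smul]
        · rw [integral_subtype_comap measurableSet_Ioi
            fun τ : ℝ => Real.toNNReal (τ ^ n) • f (τ • (θ : 𝔼 (n + 1)))]
          refine setIntegral_congr_fun measurableSet_Ioi fun τ hτ => ?_
          rw [NNReal.smul_def, Real.coe_toNNReal _ (pow_nonneg (le_of_lt hτ) _)]
        · exact (measurable_subtype_coe.pow_const _).real_toNNReal

theorem setIntegral_setIntegral_swap_of_continuous {X Y : Type} [TopologicalSpace X]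
    [TopologicalSpace Y] [T2Space X] [T2Space Y] [SecondCountableTopology X]
    [SecondCountableTopology Y] [MeasurableSpace X] [MeasurableSpace Y] [BorelSpace X]
    [BorelSpace Y] {μ : Measure X} {ν : Measure Y} [SFinite μ] [SFinite ν]
    [IsFiniteMeasureOnCompacts μ] [IsFiniteMeasureOnCompacts ν] {A : Set X} {B : Set Y}
    (hA : IsCompact A) (hB : IsCompact B) {f : X → Y → ℂ}
    (hf : Continuous (Function.uncurry f)) :
    ∫ x in A, (∫ y in B, f x y ∂ν) ∂μ = ∫ y in B, (∫ x in A, f x y ∂μ) ∂ν := by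
  refine integral_integral_swap ?_
  rw [Measure.prod_restrict]
  refine IntegrableOn.of_bound ?_ ?_ ((hA.prod hB).exists_bound_of_continuousOn hf.continuousOn).choose ?_
  · rw [Measure.prod_prod]
    exact ENNReal.mul_lt_top hA.measure_lt_top hB.measure_lt_top
  · exact hf.aestronglyMeasurable
  · filter_upwards [ae_restrict_mem (hA.measurableSet.prod hB.measurableSet)] with p hp
    exact ((hA.prod hB).exists_bound_of_continuousOn hf.continuousOn).choose_spec p hp

/-- The substitution `t = s²τ`. As `τ ≥ 1`, the endpoint `S²τ` lies beyond the support of `h`, so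
the value does not depend on `τ` and may be averaged over `τ`. -/
theorem setIntegral_comp_sq_mul {h : ℝ → ℂ} (hh : Continuous h) {S τ : ℝ} (hS : 0 ≤ S)
    (hτ : 1 ≤ τ) (h0 : ∀ t, S ^ 2 ≤ t → h t = 0) :
    ∫ s in Icc 0 S, (2 * s * τ : ℝ) • h (s ^ 2 * τ) = ∫ t in Ioi (0 : ℝ), h t := by
  have h1 : ∫ s in (0 : ℝ)..S, (2 * s * τ : ℝ) • (h ∘ fun s => s ^ 2 * τ) s
      = ∫ t in (0 ^ 2 * τ)..(S ^ 2 * τ), h t := by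
    refine intervalIntegral.integral_deriv_smul_comp' (f := fun s => s ^ 2 * τ) (fun s _ => ?_)
      (by fun_prop) hh.continuousOn
    simpa using ((hasDerivAt_pow 2 s).mul_const τ)
  rw [integral_Icc_eq_integral_Ioc, ← intervalIntegral.integral_of_le hS]
  refine h1.trans ?_
  have hle : S ^ 2 ≤ S ^ 2 * τ := le_mul_of_one_le_right (sq_nonneg S) hτ
  rw [intervalIntegral.integral_of_le (by nlinarith [sq_nonneg S])]
  symm
  rw [show (0 : ℝ) ^ 2 * τ = 0 by ring]
  refine setIntegral_eq_of_subset_of_forall_sdiff_eq_zero measurableSet_Ioi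
    Ioc_subset_Ioi_self fun t ht => h0 t ?_
  have := ht.2
  simp only [mem_Ioc, not_and, not_le] at this
  exact hle.trans (this ht.1).le

end Polar

section Normalization

/-- A smooth probability density on the line that is supported in `(1, 2)`. -/
def radialBump : ContDiffBump (3 / 2 : ℝ) where
  rIn := 1 / 8
  rOut := 1 / 4
  rIn_pos := by norm_num
  rIn_lt_rOut := by norm_num

theorem radialBump_eq_zero {τ : ℝ} (h : τ ∉ Icc (1 : ℝ) 2) : radialBump.normed volume τ = 0 := by
  have h1 := radialBump.support_normed_eq (μ := volume)
  by_contra h2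
  have h3 : τ ∈ Function.support (radialBump.normed volume) := h2
  rw [h1, Real.ball_eq_Ioo, radialBump] at h3
  refine h ⟨?_, ?_⟩ <;> linarith [h3.1, h3.2]

theorem setIntegral_radialBump :
    ∫ τ in Icc (1 : ℝ) 2, radialBump.normed volume τ = 1 := by
  rw [setIntegral_eq_integral_of_forall_compl_eq_zero fun τ hτ => radialBump_eq_zero hτ]
  exact radialBump.integral_normed

end Normalization

section SphereProjection

variable {n : ℕ}

/-- The point `w / |w|` of the unit sphere, with an arbitrary value at `w = 0`. -/
def sphereProj (w : 𝔼 (n + 1)) : Metric.sphere (0 : 𝔼 (n + 1)) 1 :=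
  if h : w = 0 then ⟨EuclideanSpace.single 0 1, by simp⟩
  else ⟨‖w‖⁻¹ • w, by simp [norm_smul, h]⟩

theorem sphereProj_smul {τ : ℝ} (hτ : 0 < τ) (θ : Metric.sphere (0 : 𝔼 (n + 1)) 1) :
    sphereProj (τ • (θ : 𝔼 (n + 1))) = θ := by
  have hθ : ‖(θ : 𝔼 (n + 1))‖ = 1 := by simp
  have h : τ • (θ : 𝔼 (n + 1)) ≠ 0 := by
    rw [← norm_ne_zero_iff, norm_smul, hθ]
    simpa using hτ.ne'
  rw [sphereProj, dif_neg h]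
  ext1
  simp only [norm_smul, hθ, Real.norm_of_nonneg hτ.le, mul_one, smul_smul,
    inv_mul_cancel₀ hτ.ne', one_smul]

theorem contMDiffAt_sphereProj {w : 𝔼 (n + 1)} (hw : w ≠ 0) :
    ContMDiffAt 𝓘(ℝ, 𝔼 (n + 1)) (𝓡 n) ∞ (sphereProj (n := n)) w := by
  -- The punctured space is treated as a manifold of its own, because `ContMDiff.codRestrict_sphere`
  -- asks for a map that is smooth on its whole domain.
  let U : TopologicalSpace.Opens (𝔼 (n + 1)) := ⟨{0}ᶜ, isOpen_compl_singleton⟩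
  have hU : ∀ v : U, (v : 𝔼 (n + 1)) ≠ 0 := fun v => v.2
  have h1 : ContMDiff 𝓘(ℝ, 𝔼 (n + 1)) 𝓘(ℝ, 𝔼 (n + 1)) ∞
      fun v : U => ‖(v : 𝔼 (n + 1))‖⁻¹ • (v : 𝔼 (n + 1)) := fun v => by
    have h2 : ContDiffAt ℝ ∞ (fun v : 𝔼 (n + 1) => ‖v‖⁻¹ • v) v :=
      ((contDiffAt_norm ℝ (hU v)).inv (norm_ne_zero_iff.2 (hU v))).smul contDiffAt_id
    exact contMDiffAt_subtype_iff.2 h2.contMDiffAt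
  have h3 := ContMDiff.codRestrict_sphere (n := n) h1 fun v => by simp [norm_smul, hU v]
  rw [show w = ((⟨w, hw⟩ : U) : 𝔼 (n + 1)) from rfl, ← contMDiffAt_subtype_iff]
  refine (h3 ⟨w, hw⟩).congr_of_eventuallyEq (.of_forall fun v => ?_)
  change sphereProj (v : 𝔼 (n + 1)) = _
  rw [sphereProj, dif_neg (hU v)]
  rfl

end SphereProjection

/-! ### The ray symbol as an oscillatory integral -/

section RayAmplitude

variable {n : ℕ}

/-- The amplitude of the symbol `raySymbol a` in the coordinates `t θ = s² w`. -/
def rayAmplitude (a : 𝔼 (n + 1) → Metric.sphere (0 : 𝔼 (n + 1)) 1 → ℝ → ℂ) (x : 𝔼 (n + 1))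
    (q : ℝ × 𝔼 (n + 1)) : ℂ :=
  (2 * radialBump.normed volume ‖q.2‖ * ‖q.2‖ * (‖q.2‖ ^ n)⁻¹ : ℝ) •
    a x (sphereProj q.2) (q.1 ^ 2 * ‖q.2‖)

variable {Ω : Set (𝔼 (n + 1))} {a : 𝔼 (n + 1) → Metric.sphere (0 : 𝔼 (n + 1)) 1 → ℝ → ℂ}

/-- The time `s²|w|` is nonnegative for every real `s`, so smoothness of `a` up to `t = 0` gives
smoothness across `s = 0`. The singularities of `w/|w|` and `|w|^{-n}` at the origin are hidden
because the bump vanishes for `|w| < 1`. -/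
theorem isAmplitude_rayAmplitude
    (ha : ContMDiffOn (𝓘(ℝ, 𝔼 (n + 1)).prod ((𝓡 n).prod 𝓘(ℝ, ℝ))) 𝓘(ℝ, ℂ) ∞
      (fun p : 𝔼 (n + 1) × (Metric.sphere (0 : 𝔼 (n + 1)) 1 × ℝ) => a p.1 p.2.1 p.2.2)
      (Ω ×ˢ (univ ×ˢ Ici (0 : ℝ)))) : IsAmplitude Ω (rayAmplitude a) where
  eq_zero x hx s w hw := by
    have : ‖w‖ ∉ Icc (1 : ℝ) 2 := fun h => hw.not_ge h.2
    simp [rayAmplitude, radialBump_eq_zero this]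
  contDiffOn := by
    rintro ⟨x, s, w⟩ ⟨hx, -⟩
    rcases eq_or_ne w 0 with rfl | hw
    · refine ContDiffAt.contDiffWithinAt ?_
      refine (contDiffAt_const (c := (0 : ℂ))).congr_of_eventuallyEq ?_
      have h : ∀ᶠ p : 𝔼 (n + 1) × ℝ × 𝔼 (n + 1) in 𝓝 (x, s, 0), ‖p.2.2‖ < 1 :=
        (isOpen_lt (by fun_prop) continuous_const).mem_nhds (by simp)
      filter_upwards [h] with p hp
      have : ‖p.2.2‖ ∉ Icc (1 : ℝ) 2 := fun h => hp.not_ge h.1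
      simp [Function.uncurry, rayAmplitude, radialBump_eq_zero this]
    · have hw2 : ContDiffAt ℝ ∞ (fun p : 𝔼 (n + 1) × ℝ × 𝔼 (n + 1) => ‖p.2.2‖) (x, s, w) :=
        ContDiffAt.norm ℝ (by fun_prop) hw
      have hc : ContDiffAt ℝ ∞ (fun p : 𝔼 (n + 1) × ℝ × 𝔼 (n + 1) =>
          2 * radialBump.normed volume ‖p.2.2‖ * ‖p.2.2‖ * (‖p.2.2‖ ^ n)⁻¹) (x, s, w) :=
        ((contDiffAt_const.mul (radialBump.contDiff_normed.contDiffAt.comp _ hw2)).mul hw2).mul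
          ((hw2.pow n).inv (pow_ne_zero _ (norm_ne_zero_iff.2 hw)))
      have hsp : ContMDiffAt 𝓘(ℝ, 𝔼 (n + 1) × ℝ × 𝔼 (n + 1)) (𝓡 n) ∞
          (fun p : 𝔼 (n + 1) × ℝ × 𝔼 (n + 1) => sphereProj p.2.2) (x, s, w) :=
        ContMDiffAt.comp (I' := 𝓘(ℝ, 𝔼 (n + 1))) _ (contMDiffAt_sphereProj hw)
          (ContDiffAt.contMDiffAt (by fun_prop))
      have ht : ContMDiffAt 𝓘(ℝ, 𝔼 (n + 1) × ℝ × 𝔼 (n + 1)) 𝓘(ℝ, ℝ) ∞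
          (fun p : 𝔼 (n + 1) × ℝ × 𝔼 (n + 1) => p.2.1 ^ 2 * ‖p.2.2‖) (x, s, w) :=
        ContDiffAt.contMDiffAt (ContDiffAt.mul (by fun_prop) hw2)
      have hx1 : ContMDiffAt 𝓘(ℝ, 𝔼 (n + 1) × ℝ × 𝔼 (n + 1)) 𝓘(ℝ, 𝔼 (n + 1)) ∞
          (fun p : 𝔼 (n + 1) × ℝ × 𝔼 (n + 1) => p.1) (x, s, w) :=
        ContDiffAt.contMDiffAt (by fun_prop)
      have hmap := hx1.prodMk (hsp.prodMk ht)
      have hcomp : ContMDiffWithinAt 𝓘(ℝ, 𝔼 (n + 1) × ℝ × 𝔼 (n + 1)) 𝓘(ℝ, ℂ) ∞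
          (fun p : 𝔼 (n + 1) × ℝ × 𝔼 (n + 1) => a p.1 (sphereProj p.2.2) (p.2.1 ^ 2 * ‖p.2.2‖))
          (Ω ×ˢ univ) (x, s, w) :=
        ContMDiffWithinAt.comp (x, s, w) (t := Ω ×ˢ (univ ×ˢ Ici (0 : ℝ)))
          (ha (x, sphereProj w, s ^ 2 * ‖w‖) ⟨hx, trivial, mem_Ici.2 (by positivity)⟩)
          hmap.contMDiffWithinAt fun p hp => ⟨hp.1, trivial, mem_Ici.2 (by positivity)⟩
      exact hc.contDiffWithinAt.smul hcomp.contDiffWithinAt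

/-- In polar coordinates `w = τθ`, the factor `|w|^{-n}` of the amplitude cancels the Jacobian
`τ^n`, and `2|w|` together with the weight `s` gives `dt = 2sτ ds`. After Fubini the integral over
`s` is the radial integral for every `τ`, and the density in `τ` has mass one. -/
theorem raySymbol_eq_oscIntegral
    (ha : ContinuousOn (fun p : 𝔼 (n + 1) × (Metric.sphere (0 : 𝔼 (n + 1)) 1 × ℝ) =>
      a p.1 p.2.1 p.2.2) (Ω ×ˢ (univ ×ˢ Ici (0 : ℝ))))
    (hG : IsAmplitude Ω (rayAmplitude a)) {x : 𝔼 (n + 1)} (hx : x ∈ Ω) {S : ℝ} (hS : 0 ≤ S)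
    (h0 : ∀ θ t, S ^ 2 ≤ t → a x θ t = 0) (ξ : 𝔼 (n + 1)) :
    raySymbol a x ξ = oscIntegral (rayAmplitude a) 0 S x ξ := by
  -- Nothing is known about `a` for negative times. Evaluating at `max t 0` gives a function that is
  -- continuous on all of `ℝ` and unchanged for `t ≥ 0`.
  set h : Metric.sphere (0 : 𝔼 (n + 1)) 1 → ℝ → ℂ := fun θ t =>
    a x θ (max t 0) * planeWave (-ξ) (t • (θ : 𝔼 (n + 1))) with hh
  have hcont : Continuous (Function.uncurry h) := by
    have h1 : Continuous fun p : Metric.sphere (0 : 𝔼 (n + 1)) 1 × ℝ => a x p.1 (max p.2 0) := by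
      rw [← continuousOn_univ]
      exact ha.comp (f := fun p : Metric.sphere (0 : 𝔼 (n + 1)) 1 × ℝ => (x, p.1, max p.2 0))
        (by fun_prop) fun p _ => ⟨hx, trivial, mem_Ici.2 (le_max_right _ _)⟩
    exact h1.mul (by fun_prop)
  have hzero : ∀ θ t, S ^ 2 ≤ t → h θ t = 0 := fun θ t ht => by
    simp [hh, h0 θ _ (ht.trans (le_max_left t 0))]
  set ρ := radialBump.normed (volume : Measure ℝ) with hρ
  have hρc : Continuous ρ := radialBump.contDiff_normed (n := 0).continuous
  have hGc : ∀ s, Continuous fun w => planeWave (-ξ) (s ^ 2 • w) • rayAmplitude a x (s, w) :=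
    fun s => (by fun_prop : Continuous fun w => planeWave (-ξ) (s ^ 2 • w)).smul
      (hG.contDiff_right_right hx s).continuous
  have hpolar : ∀ s, 0 ≤ s → ∫ w in Metric.closedBall (0 : 𝔼 (n + 1)) 2,
      oscIntegrand (rayAmplitude a) 0 x ξ (s, w)
      = ∫ θ, (∫ τ in Icc (1 : ℝ) 2, ρ τ • ((2 * s * τ : ℝ) • h θ (s ^ 2 * τ)))
        ∂(Measure.toSphere volume) := fun s hs => by
    have hz : ∀ w ∉ Metric.closedBall (0 : 𝔼 (n + 1)) 2,
        oscIntegrand (rayAmplitude a) 0 x ξ (s, w) = 0 := fun w hw => by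
      rw [oscIntegrand, hG.eq_zero x hx s w (by simpa using hw), smul_zero, smul_zero]
    rw [setIntegral_eq_integral_of_forall_compl_eq_zero hz,
      integral_eq_integral_sphere_integral_Ioi]
    · refine integral_congr_ae (.of_forall fun θ => ?_)
      have hθ : ‖(θ : 𝔼 (n + 1))‖ = 1 := by simp
      have h1 : ∀ τ ∈ Ioi (0 : ℝ), (τ ^ n) • oscIntegrand (rayAmplitude a) 0 x ξ
          (s, τ • (θ : 𝔼 (n + 1))) = ρ τ • ((2 * s * τ : ℝ) • h θ (s ^ 2 * τ)) := fun τ hτ => by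
        have hτ0 : (0 : ℝ) < τ := hτ
        have hτn : (τ : ℂ) ^ n ≠ 0 := pow_ne_zero _ (by exact_mod_cast hτ0.ne')
        simp only [oscIntegrand, rayAmplitude, sphereProj_smul hτ0, norm_smul, hθ,
          Real.norm_of_nonneg hτ0.le, mul_one, hh,
          max_eq_left (mul_nonneg (sq_nonneg s) hτ0.le), smul_smul, Complex.real_smul,
          smul_eq_mul, ← hρ]
        push_cast
        field_simp
      simp only
      rw [setIntegral_congr_fun measurableSet_Ioi h1]
      refine setIntegral_eq_of_subset_of_forall_sdiff_eq_zero measurableSet_Ioi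
        (fun τ hτ => lt_of_lt_of_le one_pos hτ.1) fun τ hτ => ?_
      rw [hρ, radialBump_eq_zero hτ.2, zero_smul]
    · have hc : Continuous fun w => oscIntegrand (rayAmplitude a) 0 x ξ (s, w) :=
        (hGc s).const_smul (s ^ (2 * 0 + 1))
      refine hc.integrable_of_hasCompactSupport ?_
      exact HasCompactSupport.intro (isCompact_closedBall 0 2) hz
  have hF : Continuous fun p : ℝ × Metric.sphere (0 : 𝔼 (n + 1)) 1 × ℝ =>
      ρ p.2.2 • ((2 * p.1 * p.2.2 : ℝ) • h p.2.1 (p.1 ^ 2 * p.2.2)) := by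
    have h1 : Continuous fun p : ℝ × Metric.sphere (0 : 𝔼 (n + 1)) 1 × ℝ =>
        h p.2.1 (p.1 ^ 2 * p.2.2) :=
      hcont.comp (g := Function.uncurry h) (f := fun p : ℝ × Metric.sphere (0 : 𝔼 (n + 1)) 1 × ℝ =>
        (p.2.1, p.1 ^ 2 * p.2.2)) (by fun_prop)
    fun_prop
  have hcI : Continuous (Function.uncurry fun (s : ℝ) (θ : Metric.sphere (0 : 𝔼 (n + 1)) 1) =>
      ∫ τ in Icc (1 : ℝ) 2, ρ τ • ((2 * s * τ : ℝ) • h θ (s ^ 2 * τ))) :=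
    continuous_parametric_integral_of_continuous
      (f := fun (p : ℝ × Metric.sphere (0 : 𝔼 (n + 1)) 1) τ =>
        ρ τ • ((2 * p.1 * τ : ℝ) • h p.2 (p.1 ^ 2 * τ)))
      (hF.comp (f := fun r : (ℝ × Metric.sphere (0 : 𝔼 (n + 1)) 1) × ℝ => (r.1.1, r.1.2, r.2))
        (by fun_prop)) isCompact_Icc
  have hosc : Continuous (oscIntegrand (rayAmplitude a) 0 x ξ) := by
    have h := (hG.contDiff_right hx).continuous
    unfold oscIntegrand
    exact (by fun_prop : Continuous fun q : ℝ × 𝔼 (n + 1) => q.1 ^ (2 * 0 + 1)).smul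
      ((by fun_prop : Continuous fun q : ℝ × 𝔼 (n + 1) => planeWave (-ξ) (q.1 ^ 2 • q.2)).smul h)
  symm
  calc oscIntegral (rayAmplitude a) 0 S x ξ
      -- The sphere is written as the compact set `univ` to fit the swap lemma for compact sets.
      = ∫ s in Icc 0 S, ∫ θ in univ, (∫ τ in Icc (1 : ℝ) 2,
          ρ τ • ((2 * s * τ : ℝ) • h θ (s ^ 2 * τ))) ∂(Measure.toSphere volume) := by
        rw [oscIntegral, Measure.volume_eq_prod, setIntegral_prod _
          (hosc.continuousOn.integrableOn_compact (isCompact_Icc_prod_closedBall S))]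
        refine setIntegral_congr_fun measurableSet_Icc fun s hs => ?_
        simp only [setIntegral_univ]
        exact hpolar s hs.1
    _ = ∫ θ in univ, (∫ s in Icc 0 S, ∫ τ in Icc (1 : ℝ) 2,
          ρ τ • ((2 * s * τ : ℝ) • h θ (s ^ 2 * τ))) ∂(Measure.toSphere volume) :=
        setIntegral_setIntegral_swap_of_continuous isCompact_Icc isCompact_univ hcI
    _ = raySymbol a x ξ := by
        rw [setIntegral_univ, raySymbol]
        refine integral_congr_ae (.of_forall fun θ => ?_)
        have hcθ : Continuous (h θ) := hcont.comp (f := fun t => (θ, t)) (by fun_prop)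
        simp only
        rw [setIntegral_setIntegral_swap_of_continuous isCompact_Icc isCompact_Icc
          (f := fun s τ => ρ τ • ((2 * s * τ : ℝ) • h θ (s ^ 2 * τ)))
          (hF.comp (f := fun r : ℝ × ℝ => (r.1, θ, r.2)) (by fun_prop))]
        have h1 : ∀ τ ∈ Icc (1 : ℝ) 2, ∫ s in Icc 0 S, ρ τ • ((2 * s * τ : ℝ) • h θ (s ^ 2 * τ))
            = ρ τ • ∫ t in Ioi (0 : ℝ), h θ t := fun τ hτ => by
          rw [integral_smul, setIntegral_comp_sq_mul hcθ hS hτ.1 (hzero θ)]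
        rw [setIntegral_congr_fun measurableSet_Icc h1, integral_smul_const,
          setIntegral_radialBump, one_smul]
        refine setIntegral_congr_fun measurableSet_Ioi fun t ht => ?_
        simp only [hh, max_eq_left (le_of_lt (mem_Ioi.1 ht))]

end RayAmplitude

section RaySymbol

variable {n : ℕ} {Ω : TopologicalSpace.Opens (𝔼 (n + 1))}
  {a : 𝔼 (n + 1) → Metric.sphere (0 : 𝔼 (n + 1)) 1 → ℝ → ℂ}

/-- The upper limit `S` depends on the compact set. Derivatives in `x` need the formula near `K`, so
`S` is taken from a compact `L` whose interior contains `K`. -/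
theorem isSymbol_raySymbol
    (ha : ContMDiffOn (𝓘(ℝ, 𝔼 (n + 1)).prod ((𝓡 n).prod 𝓘(ℝ, ℝ))) 𝓘(ℝ, ℂ) ∞
      (fun p : 𝔼 (n + 1) × (Metric.sphere (0 : 𝔼 (n + 1)) 1 × ℝ) => a p.1 p.2.1 p.2.2)
      ((Ω : Set (𝔼 (n + 1))) ×ˢ (univ ×ˢ Ici (0 : ℝ))))
    (hsupp : ∀ K : Set (𝔼 (n + 1)), IsCompact K → K ⊆ Ω →
      ∃ T : ℝ, ∀ x ∈ K, ∀ θ, ∀ t, T ≤ t → a x θ t = 0) :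
    IsSymbol Ω (-1 / 2) (raySymbol a) := by
  have hG := isAmplitude_rayAmplitude ha
  refine isSymbol_of_local fun K hK hKΩ => ?_
  obtain ⟨L, hL, hKL, hLΩ⟩ := exists_compact_between hK Ω.isOpen hKΩ
  obtain ⟨T, hT⟩ := hsupp L hL hLΩ
  refine ⟨oscIntegral (rayAmplitude a) 0 (Real.sqrt (max T 0)), hG.isSymbol_oscIntegral _, ?_⟩
  filter_upwards [isOpen_interior.mem_nhdsSet.2 hKL] with x hx
  ext1 ξ
  refine raySymbol_eq_oscIntegral ha.continuousOn hG (hLΩ (interior_subset hx))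
    (Real.sqrt_nonneg _) (fun θ t ht => hT x (interior_subset hx) θ t ?_) ξ
  rw [Real.sq_sqrt (le_max_right _ _)] at ht
  exact (le_max_left _ _).trans ht

end RaySymbol

/-! ### Fourier transforms of compactly supported distributions -/

section DerivativeBounds

variable {d : ℕ} {V : Type} [NormedAddCommGroup V] [NormedSpace ℝ V]

theorem continuous_iteratedFDeriv_uncurry {P E : Type} [NormedAddCommGroup P] [NormedSpace ℝ P]
    [NormedAddCommGroup E] [NormedSpace ℝ E] {F : P → E → V}
    (hF : ContDiff ℝ ∞ (Function.uncurry F)) (i : ℕ) :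
    Continuous fun p : P × E => iteratedFDeriv ℝ i (F p.1) p.2 := by
  induction i generalizing V with
  | zero =>
    simp only [iteratedFDeriv_zero_eq_comp, Function.comp_apply]
    exact (LinearIsometryEquiv.continuous _).comp hF.continuous
  | succ i ih =>
    have h : ContDiff ℝ ∞ (Function.uncurry fun p => fderiv ℝ (F p)) := by
      have := (hF.contDiffOn (s := univ ×ˢ univ)).uncurry_fderiv_right isOpen_univ
      rwa [univ_prod_univ, contDiffOn_univ] at this
    simp only [iteratedFDeriv_succ_eq_comp_right, Function.comp_apply]
    exact (LinearIsometryEquiv.continuous _).comp (ih h)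

/-- With a vector `c` as coefficient, the derivative is again a plane wave times a constant vector,
of norm `|ξ|` times that of `c`. -/
theorem norm_iteratedFDeriv_planeWave_smul_le [NormedSpace ℂ V] [IsScalarTower ℝ ℂ V]
    (ξ : 𝔼 d) (c : V) (k : ℕ) (x : 𝔼 d) :
    ‖iteratedFDeriv ℝ k (fun y => planeWave ξ y • c) x‖ ≤ ‖ξ‖ ^ k * ‖c‖ := by
  induction k generalizing V with
  | zero => simp [norm_smul, norm_planeWave]
  | succ k ih =>
    have h : fderiv ℝ (fun y => planeWave ξ y • c)
        = fun y => planeWave ξ y • (innerSL ℝ ξ).smulRight (Complex.I • c) := by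
      ext1 y
      rw [((hasFDerivAt_planeWave ξ y).smul_const c).fderiv]
      ext v
      have hre : ∀ (r : ℝ) (u : V), r • u = (r : ℂ) • u := fun r u => (algebraMap_smul ℂ r u).symm
      simp only [_root_.smul_apply, ContinuousLinearMap.smulRight_apply, hre, smul_smul,
        Complex.real_smul]
      congr 1
      ring
    rw [← norm_iteratedFDeriv_fderiv, h]
    refine (ih _).trans (le_of_eq ?_)
    rw [ContinuousLinearMap.norm_smulRight_apply, norm_smul, Complex.norm_I, innerSL_apply_norm]
    ring

theorem norm_iteratedFDeriv_planeWave_le (ξ : 𝔼 d) (k : ℕ) (x : 𝔼 d) :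
    ‖iteratedFDeriv ℝ k (planeWave ξ) x‖ ≤ ‖ξ‖ ^ k := by
  simpa using norm_iteratedFDeriv_planeWave_smul_le ξ (1 : ℂ) k x

theorem norm_iteratedFDeriv_mul_le_of_isOpen {E : Type} [NormedAddCommGroup E] [NormedSpace ℝ E]
    {U : Set E} (hU : IsOpen U) {f g : E → ℂ} (hf : ContDiffOn ℝ ∞ f U) (hg : ContDiffOn ℝ ∞ g U)
    {x : E} (hx : x ∈ U) {A B : ℝ} (hA : 0 ≤ A) (i : ℕ)
    (hfA : ∀ j ≤ i, ‖iteratedFDeriv ℝ j f x‖ ≤ A) (hgB : ∀ j ≤ i, ‖iteratedFDeriv ℝ j g x‖ ≤ B) :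
    ‖iteratedFDeriv ℝ i (fun y => f y * g y) x‖ ≤ 2 ^ i * (A * B) := by
  have h := norm_iteratedFDerivWithin_mul_le hf hg hU.uniqueDiffOn hx (n := i) (mod_cast le_top)
  simp only [iteratedFDerivWithin_of_isOpen _ hU hx] at h
  refine h.trans ?_
  calc ∑ j ∈ Finset.range (i + 1), (i.choose j : ℝ) * ‖iteratedFDeriv ℝ j f x‖
        * ‖iteratedFDeriv ℝ (i - j) g x‖
      ≤ ∑ j ∈ Finset.range (i + 1), (i.choose j : ℝ) * (A * B) := by
        refine Finset.sum_le_sum fun j hj => ?_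
        rw [mul_assoc]
        refine mul_le_mul_of_nonneg_left ?_ (by positivity)
        exact mul_le_mul (hfA j (Finset.mem_range_succ_iff.1 hj)) (hgB _ (Nat.sub_le _ _))
          (norm_nonneg _) hA
    _ = 2 ^ i * (A * B) := by
        rw [← Finset.sum_mul, ← Nat.cast_sum, Nat.sum_range_choose]
        push_cast
        rfl

/-- Unlike `IsAmplitude.integral_planeWave_decay`, the constant is explicit and linear in the
derivative bound `B`. This yields continuity with respect to the test function. -/
theorem pow_mul_norm_integral_planeWave_smul_le [NormedSpace ℂ V] [IsScalarTower ℝ ℂ V]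
    {K : Set (𝔼 d)} (hK : IsCompact K) (N : ℕ) {g : 𝔼 d → V} (hg : ContDiff ℝ ∞ g)
    (hgK : Function.support g ⊆ K) {B : ℝ}
    (hB : ∀ i ≤ N, ∀ x, ‖iteratedFDeriv ℝ i g x‖ ≤ B) (η : 𝔼 d) :
    (1 + ‖η‖) ^ N * ‖∫ x, planeWave (-η) x • g x‖ ≤ 2 ^ N * (B * volume.real K) := by
  induction N generalizing V with
  | zero =>
    rw [pow_zero, one_mul, pow_zero, one_mul, ← setIntegral_eq_integral_of_forall_compl_eq_zero (s := K)]
    · refine norm_setIntegral_le_of_norm_le_const hK.measure_lt_top fun x _ => ?_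
      rw [norm_smul, norm_planeWave, one_mul]
      simpa using hB 0 le_rfl x
    · intro x hx
      rw [Function.notMem_support.1 fun h => hx (hgK h), smul_zero]
  | succ N ih =>
    have hc : HasCompactSupport g := HasCompactSupport.intro hK fun x hx =>
      Function.notMem_support.1 fun h => hx (hgK h)
    have h1 := ih hg hgK fun i hi => hB i (hi.trans (Nat.le_succ N))
    have h2 := ih (hg.fderiv_right (m := ∞) (by simp))
      ((support_fderiv_subset ℝ).trans (closure_minimal hgK hK.isClosed)) fun i hi x => by
        rw [norm_iteratedFDeriv_fderiv]
        exact hB (i + 1) (Nat.succ_le_succ hi) x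
    have h := norm_mul_norm_integral_planeWave_smul_le (hg.of_le (by simp)) hc η
    calc _ = (1 + ‖η‖) ^ N * ‖∫ w, planeWave (-η) w • g w‖
          + (1 + ‖η‖) ^ N * (‖η‖ * ‖∫ w, planeWave (-η) w • g w‖) := by ring
      _ ≤ 2 ^ N * (B * volume.real K) + 2 ^ N * (B * volume.real K) := add_le_add h1
        ((mul_le_mul_of_nonneg_left h (by positivity)).trans h2)
      _ = _ := by ring

end DerivativeBounds

section FourierOfDistribution

variable {d : ℕ} {Ω : TopologicalSpace.Opens (𝔼 d)}

/-- On test functions with support in a fixed compact set, a distribution is bounded by finitely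
many derivatives. -/
theorem CDistribution.exists_bound (u : CDistribution Ω) {K : Set (𝔼 d)} (hK : IsCompact K)
    (hKΩ : K ⊆ Ω) : ∃ (N : ℕ) (C : ℝ), 0 ≤ C ∧ ∀ f : 𝓓(Ω, ℂ), Function.support f ⊆ K →
      ∀ M, 0 ≤ M → (∀ i ≤ N, ∀ x, ‖iteratedFDeriv ℝ i f x‖ ≤ M) → ‖u f‖ ≤ C * M := by
  let K' : TopologicalSpace.Compacts (𝔼 d) := ⟨K, hK⟩
  have hK' : (K' : Set (𝔼 d)) ⊆ Ω := hKΩ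
  let v : 𝓓_{K'}(𝔼 d, ℂ) →L[ℂ] ℂ := u.comp (TestFunction.ofSupportedInCLM ℂ hK')
  obtain ⟨s, C, -, hC⟩ := Seminorm.bound_of_continuous
    (ContDiffMapSupportedIn.withSeminorms ℂ (𝔼 d) ℂ ⊤ K')
    ((normSeminorm ℂ ℂ).comp v.toLinearMap) (continuous_norm.comp v.continuous)
  refine ⟨s.sup id, C, C.2, fun f hf M hM h => ?_⟩
  let f' : 𝓓_{K'}(𝔼 d, ℂ) := .of_support_subset f.contDiff hf
  have h1 : u f = v f' := rfl
  rw [h1]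
  refine (hC f').trans ?_
  rw [_root_.smul_apply, NNReal.smul_def, smul_eq_mul]
  refine mul_le_mul_of_nonneg_left (Seminorm.finset_sup_apply_le hM fun i hi => ?_) C.2
  rw [ContDiffMapSupportedIn.seminorm_top_le_iff ℂ hM]
  exact fun x _ => h i (Finset.le_sup (f := id) hi) x

theorem contDiff_uncurry_cutoffWave (χ : 𝓓(Ω, ℂ)) :
    ContDiff ℝ ∞ (Function.uncurry fun ξ : 𝔼 d => (cutoffWave χ ξ : 𝔼 d → ℂ)) :=
  (χ.contDiff.comp contDiff_snd).mul
    (contDiff_uncurry_planeWave.comp (f := fun p : 𝔼 d × 𝔼 d => (-p.1, p.2)) (by fun_prop))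

theorem support_cutoffWave_subset (χ : 𝓓(Ω, ℂ)) (ξ : 𝔼 d) :
    Function.support (cutoffWave χ ξ) ⊆ tsupport χ :=
  (Function.support_mul_subset_left _ _).trans (subset_tsupport _)

/-- Needed for the measurability of `û`. As `ξ → ξ₀`, the derivatives of the cut-off waves up to the
order of `u` converge uniformly on the compact support of `χ`. -/
theorem continuous_apply_cutoffWave (u : CDistribution Ω) (χ : 𝓓(Ω, ℂ)) :
    Continuous fun ξ => u (cutoffWave χ ξ) := by
  obtain ⟨N, C, hC0, hC⟩ := u.exists_bound χ.hasCompactSupport χ.tsupport_subset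
  rw [Metric.continuous_iff']
  intro ξ₀ ε hε
  -- `C + 1` avoids division by zero and makes `C · ε / (C + 1) < ε` strict.
  have hε' : 0 < ε / (C + 1) := by positivity
  have h1 : ∀ i ∈ Finset.range (N + 1), ∀ᶠ ξ in 𝓝 ξ₀, ∀ x ∈ tsupport χ,
      ‖iteratedFDeriv ℝ i (cutoffWave χ ξ) x - iteratedFDeriv ℝ i (cutoffWave χ ξ₀) x‖
        < ε / (C + 1) := fun i _ => by
    obtain ⟨v, hv, h⟩ := χ.hasCompactSupport.mem_uniformity_of_prod (s := univ) (q := ξ₀)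
      (f := fun ξ x => iteratedFDeriv ℝ i (cutoffWave χ ξ) x)
      (continuous_iteratedFDeriv_uncurry (contDiff_uncurry_cutoffWave χ) i).continuousOn
      (mem_univ _) (Metric.dist_mem_uniformity hε')
    rw [nhdsWithin_univ] at hv
    filter_upwards [hv] with ξ hξ x hx
    simpa [dist_eq_norm] using h ξ hξ x hx
  filter_upwards [(Finset.eventually_all _).2 h1] with ξ hξ
  rw [dist_eq_norm, ← map_sub]
  refine (hC (cutoffWave χ ξ - cutoffWave χ ξ₀) ?_ _ hε'.le fun i hi x => ?_).trans_lt ?_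
  · exact (Function.support_sub _ _).trans
      (union_subset (support_cutoffWave_subset χ ξ) (support_cutoffWave_subset χ ξ₀))
  · have h2 : iteratedFDeriv ℝ i (cutoffWave χ ξ - cutoffWave χ ξ₀ : 𝓓(Ω, ℂ)) x
        = iteratedFDeriv ℝ i (cutoffWave χ ξ) x - iteratedFDeriv ℝ i (cutoffWave χ ξ₀) x :=
      iteratedFDeriv_sub_apply ((cutoffWave χ ξ).contDiff.of_le (mod_cast le_top)).contDiffAt
        ((cutoffWave χ ξ₀).contDiff.of_le (mod_cast le_top)).contDiffAt
    rw [h2]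
    by_cases hx : x ∈ tsupport χ
    · exact (hξ i (Finset.mem_range_succ_iff.2 hi) x hx).le
    · have h3 : ∀ η, iteratedFDeriv ℝ i (cutoffWave χ η) x = 0 := fun η => by
        refine Function.notMem_support.1 fun h => hx ?_
        exact closure_minimal (support_cutoffWave_subset χ η) (isClosed_tsupport _)
          (support_iteratedFDeriv_subset i h)
      rw [h3, h3, sub_zero, norm_zero]
      exact hε'.le
  · rw [← mul_div_assoc, div_lt_iff₀ (by positivity)]
    linarith

theorem exists_norm_apply_cutoffWave_le (u : CDistribution Ω) (χ : 𝓓(Ω, ℂ)) :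
    ∃ (N : ℕ) (C : ℝ), 0 ≤ C ∧ ∀ ξ, ‖u (cutoffWave χ ξ)‖ ≤ C * (1 + ‖ξ‖) ^ N := by
  obtain ⟨N, C, hC0, hC⟩ := u.exists_bound χ.hasCompactSupport χ.tsupport_subset
  have hb : ∀ j, ∃ B, ∀ x, ‖iteratedFDeriv ℝ j χ x‖ ≤ B := fun j =>
    (χ.hasCompactSupport.iteratedFDeriv j).exists_bound_of_continuous
      (χ.contDiff.continuous_iteratedFDeriv (mod_cast le_top))
  choose B hB using hb
  set A := ∑ j ∈ Finset.range (N + 1), B j with hA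
  have hB0 : ∀ j, 0 ≤ B j := fun j => (norm_nonneg _).trans (hB j 0)
  have hA0 : 0 ≤ A := Finset.sum_nonneg fun j _ => hB0 j
  refine ⟨N, C * (2 ^ N * A), by positivity, fun ξ => ?_⟩
  rw [mul_assoc]
  refine hC _ (support_cutoffWave_subset χ ξ) _ (by positivity) fun i hi x => ?_
  have h1 : (1 : ℝ) ≤ 1 + ‖ξ‖ := le_add_of_nonneg_right (norm_nonneg _)
  have h := norm_iteratedFDeriv_mul_le_of_isOpen isOpen_univ χ.contDiff.contDiffOn
    (contDiff_planeWave (-ξ)).contDiffOn (mem_univ x) hA0 (B := (1 + ‖ξ‖) ^ N) i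
    (fun j hj => (hB j x).trans (Finset.single_le_sum (fun k _ => hB0 k)
      (Finset.mem_range_succ_iff.2 (hj.trans hi))))
    fun j hj => by
      refine (norm_iteratedFDeriv_planeWave_le (-ξ) j x).trans ?_
      rw [norm_neg]
      exact (pow_le_pow_left₀ (norm_nonneg _) (by linarith) j).trans
        (pow_le_pow_right₀ h1 (hj.trans hi))
  refine h.trans ?_
  rw [mul_assoc]
  exact mul_le_mul_of_nonneg_right (pow_le_pow_right₀ one_le_two hi) (by positivity)

/-- The Fourier transform of a compactly supported distribution does not depend on the cutoff. -/
theorem apply_cutoffWave_eq {u : CDistribution Ω} {K K' : Set (𝔼 d)} {χ χ' : 𝓓(Ω, ℂ)}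
    (hu : Distribution.IsVanishingOn u Kᶜ) (hu' : Distribution.IsVanishingOn u K'ᶜ)
    (hχ : ∀ᶠ y in 𝓝ˢ K, χ y = 1) (hχ' : ∀ᶠ y in 𝓝ˢ K', χ' y = 1) (ξ : 𝔼 d) :
    u (cutoffWave χ ξ) = u (cutoffWave χ' ξ) := by
  -- Both cutoffs are compared with their product: `χ - χχ'` vanishes near `K'` and `χ' - χχ'` near
  -- `K`.
  let ψ : 𝓓(Ω, ℂ) :=
    { toFun := fun y => χ y * χ' y
      contDiff' := χ.contDiff.mul χ'.contDiff
      hasCompactSupport' := χ.hasCompactSupport.mul_right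
      tsupport_subset' := tsupport_mul_subset_left.trans χ.tsupport_subset }
  have key : ∀ {L : Set (𝔼 d)} {f g h : 𝓓(Ω, ℂ)}, Distribution.IsVanishingOn u Lᶜ →
      (∀ᶠ y in 𝓝ˢ L, g y = 1) → (∀ y, h y = f y * g y) →
      u (cutoffWave f ξ) = u (cutoffWave h ξ) := by
    intro L f g h hL hg hh
    rw [← sub_eq_zero, ← map_sub]
    refine hL _ fun y hy hyL => ?_
    rw [← notMem_compl_iff (s := tsupport _)] at hy
    refine hy ?_
    rw [mem_compl_iff, notMem_tsupport_iff_eventuallyEq]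
    filter_upwards [hg.filter_mono (nhds_le_nhdsSet hyL)] with z hz
    change f z * planeWave (-ξ) z - h z * planeWave (-ξ) z = 0
    rw [hh, hz, mul_one, sub_self]
  rw [key (h := ψ) hu' hχ' fun y => rfl, key (h := ψ) hu hχ fun y => mul_comm _ _]

theorem exists_testFunction_one_nhds {K : Set (𝔼 d)} (hK : IsCompact K) (hKΩ : K ⊆ Ω) :
    ∃ χ : 𝓓(Ω, ℂ), ∀ᶠ y in 𝓝ˢ K, χ y = 1 := by
  obtain ⟨L, hL, hKL, hLΩ⟩ := exists_compact_between hK Ω.isOpen hKΩ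
  obtain ⟨f, hf1, hf0, -⟩ := exists_contMDiffMap_one_nhds_of_subset_interior 𝓘(ℝ, 𝔼 d) (n := ⊤)
    hK.isClosed hKL
  have hs : Function.support (fun y => (f y : ℂ)) ⊆ L := fun y hy => by
    by_contra h
    exact hy (by simp [hf0 y h])
  refine ⟨⟨fun y => (f y : ℂ), Complex.ofRealCLM.contDiff.comp f.contMDiff.contDiff,
    HasCompactSupport.of_support_subset_isCompact hL hs,
    (closure_minimal hs hL.isClosed).trans hLΩ⟩, ?_⟩
  filter_upwards [hf1] with y hy
  change (f y : ℂ) = 1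
  simp [hy]

end FourierOfDistribution

/-! ### The operator defined by a symbol -/

section SymbolOperator

variable {d : ℕ} {Ω : TopologicalSpace.Opens (𝔼 d)} {m : ℝ} {b : 𝔼 d → 𝔼 d → ℂ}

/-- The function `ξ ↦ ∫ φ(x) b(x, ξ) e^{i⟨x, ξ⟩} dx`. -/
def symbolPairing (b : 𝔼 d → 𝔼 d → ℂ) (φ : 𝔼 d → ℂ) (ξ : 𝔼 d) : ℂ :=
  ∫ x, φ x * b x ξ * planeWave ξ x

theorem IsSymbol.contDiff_mul (hb : IsSymbol Ω m b) (φ : 𝓓(Ω, ℂ)) :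
    ContDiff ℝ ∞ fun p : 𝔼 d × 𝔼 d => φ p.1 * b p.1 p.2 := by
  rw [contDiff_iff_contDiffAt]
  rintro ⟨x, ξ⟩
  by_cases hx : x ∈ tsupport φ
  · exact ((φ.contDiff.comp contDiff_fst).contDiffAt).mul (hb.1.contDiffAt
      ((Ω.isOpen.prod isOpen_univ).mem_nhds ⟨φ.tsupport_subset hx, trivial⟩))
  · refine (contDiffAt_const (c := (0 : ℂ))).congr_of_eventuallyEq ?_
    have h := notMem_tsupport_iff_eventuallyEq.1 hx
    filter_upwards [(continuous_fst (X := 𝔼 d) (Y := 𝔼 d)).continuousAt.eventually h] with p hp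
    simp only [hp, Pi.zero_apply, zero_mul]

theorem IsSymbol.continuous_symbolPairing (hb : IsSymbol Ω m b) (φ : 𝓓(Ω, ℂ)) :
    Continuous (symbolPairing b φ) := by
  have h1 : Continuous (Function.uncurry fun (ξ x : 𝔼 d) => φ x * b x ξ * planeWave ξ x) :=
    ((hb.contDiff_mul φ).continuous.comp continuous_swap).mul
      (by fun_prop : Continuous fun p : 𝔼 d × 𝔼 d => planeWave p.1 p.2)
  refine (continuous_parametric_integral_of_continuous (μ := volume) h1
    φ.hasCompactSupport).congr fun ξ => ?_
  refine setIntegral_eq_integral_of_forall_compl_eq_zero fun x hx => ?_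
  rw [image_eq_zero_of_notMem_tsupport hx, zero_mul, zero_mul]

theorem integrable_mul_symbol_mul_planeWave (hb : IsSymbol Ω m b) (φ : 𝓓(Ω, ℂ)) (ξ : 𝔼 d) :
    Integrable fun x => φ x * b x ξ * planeWave ξ x := by
  have h1 : Continuous fun x => φ x * b x ξ * planeWave ξ x :=
    ((hb.contDiff_mul φ).continuous.comp (f := fun x => (x, ξ)) (by fun_prop)).mul (by fun_prop)
  exact h1.integrable_of_hasCompactSupport (φ.hasCompactSupport.mul_right.mul_right)

theorem IsSymbol.symbolPairing_decay (hb : IsSymbol Ω m b) {K : Set (𝔼 d)} (hK : IsCompact K)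
    (hKΩ : K ⊆ Ω) (N : ℕ) : ∃ (N' : ℕ) (C : ℝ), 0 ≤ C ∧ ∀ φ : 𝓓(Ω, ℂ),
      Function.support φ ⊆ K → ∀ M, 0 ≤ M → (∀ i ≤ N', ∀ x, ‖iteratedFDeriv ℝ i φ x‖ ≤ M) →
      ∀ ξ, (1 + ‖ξ‖) ^ N * ‖symbolPairing b φ ξ‖ ≤ C * M := by
  have hc := fun k => hb.2 K hK hKΩ 0 k
  choose c hc using hc
  set m' : ℕ := ⌈m⌉₊
  -- The `x`-derivatives of `b` grow at most like `(1 + |ξ|)^m'`; `m'` additional integrations by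
  -- parts compensate for this.
  set N' := N + m'
  set B := ∑ k ∈ Finset.range (N' + 1), |c k|
  have hB0 : 0 ≤ B := Finset.sum_nonneg fun _ _ => abs_nonneg _
  refine ⟨N', 2 ^ N' * (2 ^ N' * B * volume.real K), by positivity, fun φ hφ M hM hφM ξ => ?_⟩
  have h1 : (1 : ℝ) ≤ 1 + ‖ξ‖ := le_add_of_nonneg_right (norm_nonneg _)
  have hbξ : ∀ k ≤ N', ∀ x ∈ K, ‖iteratedFDeriv ℝ k (fun y => b y ξ) x‖ ≤ B * (1 + ‖ξ‖) ^ m' := by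
    intro k hk x hx
    rw [← norm_iteratedFDeriv_iteratedFDeriv_zero b k x ξ]
    refine (hc k x hx ξ).trans ?_
    refine mul_le_mul ((le_abs_self _).trans (Finset.single_le_sum
      (f := fun k => |c k|) (fun _ _ => abs_nonneg _) (Finset.mem_range_succ_iff.2 hk))) ?_
      (by positivity) hB0
    rw [← Real.rpow_natCast]
    refine Real.rpow_le_rpow_of_exponent_le h1 ?_
    simpa using Nat.le_ceil m
  have hbs : ContDiffOn ℝ ∞ (fun y => b y ξ) Ω :=
    hb.1.comp (f := fun y => (y, ξ)) (by fun_prop) fun y hy => ⟨hy, trivial⟩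
  have hg : ContDiff ℝ ∞ fun x => φ x * b x ξ :=
    (hb.contDiff_mul φ).comp (f := fun x => (x, ξ)) (by fun_prop)
  have hgK : Function.support (fun x => φ x * b x ξ) ⊆ K :=
    (Function.support_mul_subset_left _ _).trans hφ
  have h := pow_mul_norm_integral_planeWave_smul_le hK N' hg hgK
    (B := 2 ^ N' * (M * (B * (1 + ‖ξ‖) ^ m'))) (fun i hi x => ?_) (-ξ)
  · have h2 : ∫ x, planeWave (-(-ξ)) x • (φ x * b x ξ) = symbolPairing b φ ξ := by
      simp only [neg_neg, smul_eq_mul, symbolPairing, mul_comm (planeWave ξ _)]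
    rw [h2, norm_neg, pow_add] at h
    have hpos : 0 < (1 + ‖ξ‖) ^ m' := by positivity
    refine le_of_mul_le_mul_right ?_ hpos
    calc _ = (1 + ‖ξ‖) ^ N * (1 + ‖ξ‖) ^ m' * ‖symbolPairing b φ ξ‖ := by ring
      _ ≤ _ := h
      _ = _ := by ring
  · by_cases hx : x ∈ K
    · refine (norm_iteratedFDeriv_mul_le_of_isOpen Ω.isOpen φ.contDiff.contDiffOn hbs (hKΩ hx) hM
        i (fun j hj => hφM j (hj.trans hi) x) fun j hj => hbξ j (hj.trans hi) x hx).trans ?_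
      exact mul_le_mul_of_nonneg_right (pow_le_pow_right₀ one_le_two hi) (by positivity)
    · have h3 : iteratedFDeriv ℝ i (fun x => φ x * b x ξ) x = 0 :=
        Function.notMem_support.1 fun h => hx
          (closure_minimal hgK hK.isClosed (support_iteratedFDeriv_subset i h))
      rw [h3, norm_zero]
      positivity

/-- The integral of `û(ξ) ∫ φ(x) b(x, ξ) e^{i⟨x, ξ⟩} dx` converges, and is bounded by finitely many
derivatives of `φ`. -/
theorem IsSymbol.exists_integrable_norm_integral_le (hb : IsSymbol Ω m b) (u : CDistribution Ω)
    (χ : 𝓓(Ω, ℂ)) {K : Set (𝔼 d)} (hK : IsCompact K) (hKΩ : K ⊆ Ω) :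
    ∃ (N : ℕ) (C : ℝ), 0 ≤ C ∧ ∀ φ : 𝓓(Ω, ℂ), Function.support φ ⊆ K →
      Integrable (fun ξ => u (cutoffWave χ ξ) * symbolPairing b φ ξ) ∧
      ∀ M, 0 ≤ M → (∀ i ≤ N, ∀ x, ‖iteratedFDeriv ℝ i φ x‖ ≤ M) →
      ‖∫ ξ, u (cutoffWave χ ξ) * symbolPairing b φ ξ‖ ≤ C * M := by
  obtain ⟨N₁, C₁, hC₁, h₁⟩ := exists_norm_apply_cutoffWave_le u χ
  -- `N₁` powers absorb the growth of `û`, and the remaining `d + 1` make the integral over `ℝ^d`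
  -- converge.
  obtain ⟨N, C₂, hC₂, h₂⟩ := hb.symbolPairing_decay hK hKΩ (N₁ + (d + 1))
  have hI : Integrable fun ξ : 𝔼 d => (1 + ‖ξ‖) ^ (-((d + 1 : ℕ) : ℝ)) :=
    integrable_one_add_norm (by simp)
  have key : ∀ φ : 𝓓(Ω, ℂ), Function.support φ ⊆ K → ∀ M, 0 ≤ M →
      (∀ i ≤ N, ∀ x, ‖iteratedFDeriv ℝ i φ x‖ ≤ M) → ∀ ξ,
      ‖u (cutoffWave χ ξ) * symbolPairing b φ ξ‖
        ≤ C₁ * C₂ * M * (1 + ‖ξ‖) ^ (-((d + 1 : ℕ) : ℝ)) := by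
    intro φ hφ M hM hφM ξ
    have hp : 0 < 1 + ‖ξ‖ := by positivity
    rw [Real.rpow_neg hp.le, Real.rpow_natCast, ← div_eq_mul_inv, le_div_iff₀ (by positivity),
      norm_mul]
    have h := h₂ φ hφ M hM hφM ξ
    calc _ ≤ C₁ * (1 + ‖ξ‖) ^ N₁ * ‖symbolPairing b φ ξ‖ * (1 + ‖ξ‖) ^ (d + 1) := by
          gcongr
          exact h₁ ξ
      _ = C₁ * ((1 + ‖ξ‖) ^ (N₁ + (d + 1)) * ‖symbolPairing b φ ξ‖) := by ring
      _ ≤ C₁ * (C₂ * M) := by gcongr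
      _ = _ := by ring
  refine ⟨N, C₁ * C₂ * ∫ ξ : 𝔼 d, (1 + ‖ξ‖) ^ (-((d + 1 : ℕ) : ℝ)),
    mul_nonneg (mul_nonneg hC₁ hC₂) (integral_nonneg fun ξ => by positivity),
    fun φ hφ => ⟨?_, fun M hM hφM => ?_⟩⟩
  · have hbd : ∀ j, ∃ B, ∀ x, ‖iteratedFDeriv ℝ j φ x‖ ≤ B := fun j =>
      (φ.hasCompactSupport.iteratedFDeriv j).exists_bound_of_continuous
        (φ.contDiff.continuous_iteratedFDeriv (mod_cast le_top))
    choose B hB using hbd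
    have hB0 : ∀ j, 0 ≤ B j := fun j => (norm_nonneg _).trans (hB j 0)
    refine (hI.const_mul (C₁ * C₂ * ∑ j ∈ Finset.range (N + 1), B j)).mono'
      ((continuous_apply_cutoffWave u χ).mul
        (hb.continuous_symbolPairing φ)).aestronglyMeasurable (.of_forall ?_)
    exact key φ hφ _ (Finset.sum_nonneg fun j _ => hB0 j) fun i hi x => (hB i x).trans
      (Finset.single_le_sum (fun k _ => hB0 k) (Finset.mem_range_succ_iff.2 hi))
  · refine (norm_integral_le_of_norm_le (hI.const_mul (C₁ * C₂ * M))
      (.of_forall (key φ hφ M hM hφM))).trans (le_of_eq ?_)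
    rw [integral_const_mul]
    ring

theorem IsSymbol.integrable_mul_symbolPairing (hb : IsSymbol Ω m b) (u : CDistribution Ω)
    (χ φ : 𝓓(Ω, ℂ)) : Integrable fun ξ => u (cutoffWave χ ξ) * symbolPairing b φ ξ := by
  obtain ⟨N, C, -, h⟩ := hb.exists_integrable_norm_integral_le u χ φ.hasCompactSupport
    φ.tsupport_subset
  exact (h φ (subset_tsupport _)).1

theorem IsSymbol.symbolPairing_add (hb : IsSymbol Ω m b) (φ ψ : 𝓓(Ω, ℂ)) (ξ : 𝔼 d) :
    symbolPairing b (φ + ψ : 𝓓(Ω, ℂ)) ξ = symbolPairing b φ ξ + symbolPairing b ψ ξ := by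
  rw [symbolPairing, symbolPairing, symbolPairing, ← integral_add
    (integrable_mul_symbol_mul_planeWave hb φ ξ) (integrable_mul_symbol_mul_planeWave hb ψ ξ)]
  congr 1
  ext x
  change (φ x + ψ x) * _ * _ = _
  ring

theorem symbolPairing_smul (c : ℂ) (φ : 𝓓(Ω, ℂ)) (ξ : 𝔼 d) :
    symbolPairing b (c • φ : 𝓓(Ω, ℂ)) ξ = c * symbolPairing b φ ξ := by
  rw [symbolPairing, symbolPairing, ← integral_const_mul]
  congr 1
  ext x
  change (c * φ x) * _ * _ = _
  ring

/-- The distribution `φ ↦ (2π)^(-d) ∫ û(ξ) (∫ φ(x) b(x, ξ) e^{i⟨x, ξ⟩} dx) dξ`. -/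
def IsSymbol.toDist (hb : IsSymbol Ω m b) (u : CDistribution Ω) (χ : 𝓓(Ω, ℂ)) : CDistribution Ω :=
  TestFunction.mkCLM ℂ
    (fun φ => ((2 * (Real.pi : ℂ)) ^ d)⁻¹ * ∫ ξ, u (cutoffWave χ ξ) * symbolPairing b φ ξ)
    (fun φ ψ => by
      simp_rw [hb.symbolPairing_add, mul_add]
      rw [integral_add (hb.integrable_mul_symbolPairing u χ φ)
        (hb.integrable_mul_symbolPairing u χ ψ), mul_add])
    (fun c φ => by
      simp_rw [symbolPairing_smul, mul_left_comm _ c]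
      rw [integral_const_mul, smul_eq_mul, mul_left_comm])
    (fun K hK => by
      obtain ⟨N, C, hC, h⟩ := hb.exists_integrable_norm_integral_le u χ K.isCompact hK
      refine continuous_const.mul ?_
      refine (ContDiffMapSupportedIn.mkCLMtoNormedSpace (𝕜 := ℂ)
        (fun f : 𝓓_{K}(𝔼 d, ℂ) => ∫ ξ, u (cutoffWave χ ξ)
          * symbolPairing b (TestFunction.ofSupportedIn hK f) ξ) (fun f g => ?_) (fun c f => ?_)
          ⟨Finset.range (N + 1), C, hC, fun f => ?_⟩).continuous
      · have h1 : ∀ ξ, symbolPairing b (TestFunction.ofSupportedIn hK (f + g)) ξ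
            = symbolPairing b (TestFunction.ofSupportedIn hK f) ξ
              + symbolPairing b (TestFunction.ofSupportedIn hK g) ξ :=
          hb.symbolPairing_add (TestFunction.ofSupportedIn hK f) (TestFunction.ofSupportedIn hK g)
        simp_rw [h1, mul_add]
        exact integral_add (hb.integrable_mul_symbolPairing u χ _)
          (hb.integrable_mul_symbolPairing u χ _)
      · have h1 : ∀ ξ, symbolPairing b (TestFunction.ofSupportedIn hK (c • f)) ξ
            = c * symbolPairing b (TestFunction.ofSupportedIn hK f) ξ :=
          symbolPairing_smul c (TestFunction.ofSupportedIn hK f)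
        simp_rw [h1, mul_left_comm _ c]
        rw [integral_const_mul, smul_eq_mul]
      · refine (h (TestFunction.ofSupportedIn hK f) f.support_subset).2 _ (apply_nonneg _ _)
          fun i hi x => ?_
        exact (ContDiffMapSupportedIn.norm_iteratedFDeriv_apply_le_seminorm_top ℂ).trans
          (Seminorm.le_finset_sup_apply (Finset.mem_range_succ_iff.2 hi)))

theorem IsSymbol.toDist_apply (hb : IsSymbol Ω m b) (u : CDistribution Ω) (χ φ : 𝓓(Ω, ℂ)) :
    hb.toDist u χ φ = ((2 * (Real.pi : ℂ)) ^ d)⁻¹ *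
      ∫ ξ, u (cutoffWave χ ξ) * symbolPairing b φ ξ := rfl

theorem IsSymbol.toDist_eq (hb : IsSymbol Ω m b) {u : CDistribution Ω} {K K' : Set (𝔼 d)}
    {χ χ' : 𝓓(Ω, ℂ)} (hu : Distribution.IsVanishingOn u Kᶜ)
    (hu' : Distribution.IsVanishingOn u K'ᶜ) (hχ : ∀ᶠ y in 𝓝ˢ K, χ y = 1)
    (hχ' : ∀ᶠ y in 𝓝ˢ K', χ' y = 1) : hb.toDist u χ = hb.toDist u χ' := by
  ext φ
  simp_rw [toDist_apply, apply_cutoffWave_eq hu hu' hχ hχ']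

/-- A cutoff function that equals `1` near a compact set which carries `u`. -/
theorem compactDist.exists_cutoff (u : compactDist Ω) : ∃ (K : Set (𝔼 d)) (χ : 𝓓(Ω, ℂ)),
    Distribution.IsVanishingOn (u : CDistribution Ω) Kᶜ ∧ ∀ᶠ y in 𝓝ˢ K, χ y = 1 := by
  obtain ⟨K, hK, hKΩ, hu⟩ := u.2
  obtain ⟨χ, hχ⟩ := exists_testFunction_one_nhds hK hKΩ
  exact ⟨K, χ, hu, hχ⟩

theorem compactDist.exists_common_cutoff (u v : compactDist Ω) :
    ∃ (K : Set (𝔼 d)) (χ : 𝓓(Ω, ℂ)), Distribution.IsVanishingOn (u : CDistribution Ω) Kᶜ ∧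
      Distribution.IsVanishingOn (v : CDistribution Ω) Kᶜ ∧ ∀ᶠ y in 𝓝ˢ K, χ y = 1 := by
  obtain ⟨K, hK, hKΩ, hu⟩ := u.2
  obtain ⟨L, hL, hLΩ, hv⟩ := v.2
  obtain ⟨χ, hχ⟩ := exists_testFunction_one_nhds (hK.union hL) (union_subset hKΩ hLΩ)
  exact ⟨K ∪ L, χ, hu.mono (compl_subset_compl.2 subset_union_left),
    hv.mono (compl_subset_compl.2 subset_union_right), hχ⟩

/-- Every symbol defines a pseudodifferential operator. -/
theorem IsSymbol.exists_hasSymbol (hb : IsSymbol Ω m b) :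
    ∃ A : compactDist Ω →ₗ[ℂ] CDistribution Ω, HasSymbol A b := by
  -- The cutoff is chosen separately for each `u`. Linearity holds because the result does not
  -- depend on it, so that a common cutoff can be used for `u`, `v` and `u + v`.
  choose K χ hK hχ using compactDist.exists_cutoff (Ω := Ω)
  have heq : ∀ (u : compactDist Ω) (L : Set (𝔼 d)) (χ' : 𝓓(Ω, ℂ)),
      Distribution.IsVanishingOn (u : CDistribution Ω) Lᶜ → (∀ᶠ y in 𝓝ˢ L, χ' y = 1) →
      hb.toDist u (χ u) = hb.toDist u χ' := fun u L χ' hL hχ' =>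
    hb.toDist_eq (hK u) hL (hχ u) hχ'
  refine ⟨⟨⟨fun u => hb.toDist u (χ u), fun u v => ?_⟩, fun c u => ?_⟩, fun u L χ' _ hL hχ' φ => ?_⟩
  · obtain ⟨L, ψ, hu, hv, hψ⟩ := compactDist.exists_common_cutoff u v
    have huv : Distribution.IsVanishingOn ((u + v : compactDist Ω) : CDistribution Ω) Lᶜ :=
      fun φ hφ => by
        change (u : CDistribution Ω) φ + (v : CDistribution Ω) φ = 0
        rw [hu φ hφ, hv φ hφ, add_zero]
    rw [heq u L ψ hu hψ, heq v L ψ hv hψ, heq (u + v) L ψ huv hψ]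
    ext φ
    change hb.toDist _ _ φ = hb.toDist _ _ φ + hb.toDist _ _ φ
    rw [toDist_apply, toDist_apply, toDist_apply, ← mul_add, ← integral_add
      (hb.integrable_mul_symbolPairing _ _ _) (hb.integrable_mul_symbolPairing _ _ _)]
    simp_rw [← add_mul]
    rfl
  · have hcu : Distribution.IsVanishingOn ((c • u : compactDist Ω) : CDistribution Ω) (K u)ᶜ :=
      fun φ hφ => by
        change c • (u : CDistribution Ω) φ = 0
        rw [hK u φ hφ, smul_zero]
    change hb.toDist _ (χ (c • u)) = c • hb.toDist _ (χ u)
    rw [heq (c • u) (K u) (χ u) hcu (hχ u)]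
    ext φ
    change hb.toDist _ _ φ = c * hb.toDist _ _ φ
    rw [toDist_apply, toDist_apply, mul_left_comm]
    refine congrArg _ (Eq.trans ?_ (integral_const_mul c _))
    exact (integral_congr_ae (.of_forall fun ξ => mul_assoc c _ _))
  · change hb.toDist _ _ φ = _
    rw [heq u L χ' hL hχ']
    rfl

end SymbolOperator

/-! ### Fourier inversion and the action on test functions -/

section TestFunctionFourier

variable {d : ℕ} {Ω : TopologicalSpace.Opens (𝔼 d)}

/-- The function `ξ ↦ ∫ e^{-i⟨y, ξ⟩} q(y) dy`. -/
def planeWaveTransform (q : 𝔼 d → ℂ) (ξ : 𝔼 d) : ℂ := ∫ y, planeWave (-ξ) y * q y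

theorem continuous_planeWaveTransform (q : 𝓓(Ω, ℂ)) : Continuous (planeWaveTransform q) := by
  have h1 : Continuous (Function.uncurry fun (ξ y : 𝔼 d) => planeWave (-ξ) y * q y) := by
    have := q.contDiff.continuous
    unfold Function.uncurry
    fun_prop
  refine (continuous_parametric_integral_of_continuous (μ := volume) h1
    q.hasCompactSupport).congr fun ξ => ?_
  refine setIntegral_eq_integral_of_forall_compl_eq_zero fun x hx => ?_
  rw [image_eq_zero_of_notMem_tsupport hx, mul_zero]

theorem exists_norm_planeWaveTransform_le (q : 𝓓(Ω, ℂ)) (N : ℕ) :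
    ∃ C, 0 ≤ C ∧ ∀ ξ, (1 + ‖ξ‖) ^ N * ‖planeWaveTransform q ξ‖ ≤ C := by
  have hb : ∀ j, ∃ B, ∀ x, ‖iteratedFDeriv ℝ j q x‖ ≤ B := fun j =>
    (q.hasCompactSupport.iteratedFDeriv j).exists_bound_of_continuous
      (q.contDiff.continuous_iteratedFDeriv (mod_cast le_top))
  choose B hB using hb
  have hB0 : ∀ j, 0 ≤ B j := fun j => (norm_nonneg _).trans (hB j 0)
  set A := ∑ j ∈ Finset.range (N + 1), B j
  have hA0 : 0 ≤ A := Finset.sum_nonneg fun j _ => hB0 j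
  refine ⟨2 ^ N * (A * volume.real (tsupport q)), by positivity, fun ξ => ?_⟩
  exact pow_mul_norm_integral_planeWave_smul_le q.hasCompactSupport N q.contDiff
    (subset_tsupport _) (fun i hi x => (hB i x).trans
      (Finset.single_le_sum (fun k _ => hB0 k) (Finset.mem_range_succ_iff.2 hi))) ξ

theorem integrable_planeWaveTransform (q : 𝓓(Ω, ℂ)) : Integrable (planeWaveTransform q) := by
  obtain ⟨C, hC, h⟩ := exists_norm_planeWaveTransform_le q (d + 1)
  have hI : Integrable fun ξ : 𝔼 d => (1 + ‖ξ‖) ^ (-((d + 1 : ℕ) : ℝ)) :=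
    integrable_one_add_norm (by simp)
  refine (hI.const_mul C).mono' (continuous_planeWaveTransform q).aestronglyMeasurable
    (.of_forall fun ξ => ?_)
  have hp : 0 < 1 + ‖ξ‖ := by positivity
  rw [Real.rpow_neg hp.le, Real.rpow_natCast, ← div_eq_mul_inv, le_div_iff₀ (by positivity),
    mul_comm]
  exact h ξ

theorem fourier_eq_planeWaveTransform (q : 𝔼 d → ℂ) (w : 𝔼 d) :
    FourierTransform.fourier q w = planeWaveTransform q ((2 * Real.pi) • w) := by
  rw [Real.fourier_eq', planeWaveTransform]
  refine integral_congr_ae (.of_forall fun v => ?_)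
  simp only [planeWave, smul_eq_mul, inner_neg_right, inner_smul_right, neg_mul]

/-- Fourier inversion for test functions. -/
theorem integral_planeWave_mul_planeWaveTransform (q : 𝓓(Ω, ℂ)) (x : 𝔼 d) :
    ∫ ξ, planeWave ξ x * planeWaveTransform q ξ = (2 * (Real.pi : ℂ)) ^ d * q x := by
  have hq : Integrable q := q.contDiff.continuous.integrable_of_hasCompactSupport q.hasCompactSupport
  have h2 : (2 * Real.pi) ≠ 0 := by positivity
  have hF : FourierTransform.fourier (q : 𝔼 d → ℂ)
      = fun w => planeWaveTransform q ((2 * Real.pi) • w) :=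
    funext (fourier_eq_planeWaveTransform q)
  have hFI : Integrable (FourierTransform.fourier (q : 𝔼 d → ℂ)) := by
    rw [hF]
    exact (integrable_planeWaveTransform q).comp_smul h2
  have h := hq.fourierInv_fourier_eq hFI (v := x) q.contDiff.continuous.continuousAt
  rw [Real.fourierInv_eq'] at h
  have h3 : ∀ v : 𝔼 d, Complex.exp (((2 * Real.pi * inner ℝ v x : ℝ) : ℂ) * Complex.I)
      • FourierTransform.fourier (q : 𝔼 d → ℂ) v = (fun ξ => planeWave ξ x *
        planeWaveTransform q ξ) ((2 * Real.pi) • v) := fun v => by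
    rw [hF]
    simp only [planeWave, smul_eq_mul, inner_smul_right, real_inner_comm]
  -- The dilation `ξ = 2πv` passes from the unitary normalization to the present one and produces
  -- `(2π)^(-d)`.
  rw [integral_congr_ae (.of_forall h3), Measure.integral_comp_smul_of_nonneg volume
    (fun ξ => planeWave ξ x * planeWaveTransform q ξ) _ (hR := by positivity)] at h
  rw [← h, finrank_euclideanSpace_fin, Complex.real_smul]
  push_cast
  rw [mul_inv_cancel_left₀ (by simp [Real.pi_ne_zero])]

end TestFunctionFourier

section SymbolOpOnTestFunctions

variable {d : ℕ} {Ω : TopologicalSpace.Opens (𝔼 d)} {m : ℝ} {b : 𝔼 d → 𝔼 d → ℂ}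

/-- The rapid decay of the transform of `q` beats the polynomial growth of `b`. The majorant is used
both for continuity of `symbolOp b q` and for Fubini. -/
theorem IsSymbol.exists_integrable_bound (hb : IsSymbol Ω m b) {K : Set (𝔼 d)} (hK : IsCompact K)
    (hKΩ : K ⊆ Ω) (q : 𝓓(Ω, ℂ)) : ∃ g : 𝔼 d → ℝ, Integrable g ∧ ∀ x ∈ K, ∀ ξ,
      ‖planeWave ξ x * b x ξ * planeWaveTransform q ξ‖ ≤ g ξ := by
  obtain ⟨C, hC⟩ := hb.2 K hK hKΩ 0 0
  set m' : ℕ := ⌈m⌉₊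
  obtain ⟨D, hD0, hD⟩ := exists_norm_planeWaveTransform_le q (m' + (d + 1))
  have hI : Integrable fun ξ : 𝔼 d => (1 + ‖ξ‖) ^ (-((d + 1 : ℕ) : ℝ)) :=
    integrable_one_add_norm (by simp)
  refine ⟨_, hI.const_mul (|C| * D), fun x hx ξ => ?_⟩
  have hp : 0 < 1 + ‖ξ‖ := by positivity
  have h1 : (1 : ℝ) ≤ 1 + ‖ξ‖ := le_add_of_nonneg_right (norm_nonneg _)
  have hbx : ‖b x ξ‖ ≤ |C| * (1 + ‖ξ‖) ^ m' := by
    have h := hC x hx ξ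
    rw [norm_iteratedFDeriv_iteratedFDeriv_zero, norm_iteratedFDeriv_zero] at h
    refine h.trans (mul_le_mul (le_abs_self _) ?_ (by positivity) (abs_nonneg _))
    rw [← Real.rpow_natCast]
    refine Real.rpow_le_rpow_of_exponent_le h1 ?_
    simpa using Nat.le_ceil m
  rw [Real.rpow_neg hp.le, Real.rpow_natCast, ← div_eq_mul_inv, le_div_iff₀ (by positivity),
    norm_mul, norm_mul, norm_planeWave, one_mul]
  calc _ ≤ |C| * (1 + ‖ξ‖) ^ m' * ‖planeWaveTransform q ξ‖ * (1 + ‖ξ‖) ^ (d + 1) := by gcongr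
    _ = |C| * ((1 + ‖ξ‖) ^ (m' + (d + 1)) * ‖planeWaveTransform q ξ‖) := by ring
    _ ≤ _ := by
      gcongr
      exact hD ξ

theorem IsSymbol.continuousOn_symbolOp (hb : IsSymbol Ω m b) (q : 𝓓(Ω, ℂ)) :
    ContinuousOn (symbolOp b q) Ω := by
  intro x hx
  obtain ⟨K, hK, hxK, hKΩ⟩ := exists_compact_subset Ω.isOpen hx
  obtain ⟨g, hg, hbound⟩ := hb.exists_integrable_bound hK hKΩ q
  have hbc : ContinuousOn (fun p : 𝔼 d × 𝔼 d => b p.1 p.2) (Ω ×ˢ univ) := hb.1.continuousOn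
  refine ContinuousAt.continuousWithinAt (continuousAt_const.mul ?_)
  refine continuousAt_of_dominated (bound := g) ?_ ?_ hg ?_
  · filter_upwards [Ω.isOpen.mem_nhds hx] with y hy
    have h1 : Continuous (b y) := by
      rw [← continuousOn_univ]
      exact hbc.comp (f := fun ξ => (y, ξ)) (by fun_prop) fun ξ _ => ⟨hy, trivial⟩
    exact (((by fun_prop : Continuous fun ξ : 𝔼 d => planeWave ξ y).mul h1).mul
      (continuous_planeWaveTransform q)).aestronglyMeasurable
  · filter_upwards [isOpen_interior.mem_nhds hxK] with y hy
    exact .of_forall fun ξ => hbound y (interior_subset hy) ξ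
  · refine .of_forall fun ξ => ?_
    have h1 : ContinuousAt (fun y => b y ξ) x :=
      ContinuousAt.comp (f := fun y => (y, ξ)) (hbc.continuousAt
        ((Ω.isOpen.prod isOpen_univ).mem_nhds ⟨hx, trivial⟩)) (by fun_prop)
    exact ((by fun_prop : Continuous fun y : 𝔼 d => planeWave ξ y).continuousAt.mul h1).mul
      continuousAt_const

theorem functionDist_apply {f : 𝔼 d → ℂ} (hf : LocallyIntegrableOn f Ω) (φ : 𝓓(Ω, ℂ)) :
    functionDist Ω f φ = ∫ x, φ x * f x :=
  TestFunction.integralAgainstBilinCLM_eq_integral hf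

theorem functionDist_congr {f g : 𝔼 d → ℂ} (hf : LocallyIntegrableOn f Ω) (h : EqOn f g Ω) :
    functionDist Ω f = functionDist Ω g := by
  have hg : LocallyIntegrableOn g Ω :=
    hf.congr ((ae_restrict_mem Ω.isOpen.measurableSet).mono fun x hx => h hx)
  ext φ
  rw [functionDist_apply hf, functionDist_apply hg]
  refine integral_congr_ae (.of_forall fun x => ?_)
  by_cases hx : x ∈ tsupport φ
  · simp only [h (φ.tsupport_subset hx)]
  · simp only [image_eq_zero_of_notMem_tsupport hx, zero_mul]

theorem functionDist_cutoffWave {q χ : 𝓓(Ω, ℂ)} (hχ : ∀ᶠ y in 𝓝ˢ (tsupport q), χ y = 1)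
    (ξ : 𝔼 d) : functionDist Ω q (cutoffWave χ ξ) = planeWaveTransform q ξ := by
  rw [functionDist_apply (q.contDiff.continuous.locallyIntegrable.locallyIntegrableOn _)]
  refine integral_congr_ae (.of_forall fun y => ?_)
  change χ y * planeWave (-ξ) y * q y = planeWave (-ξ) y * q y
  by_cases hy : y ∈ tsupport q
  · rw [hχ.self_of_nhdsSet y hy, one_mul]
  · rw [image_eq_zero_of_notMem_tsupport hy, mul_zero, mul_zero]

theorem IsSymbol.integral_planeWaveTransform_mul_symbolPairing (hb : IsSymbol Ω m b)
    (q φ : 𝓓(Ω, ℂ)) : ∫ ξ, planeWaveTransform q ξ * symbolPairing b φ ξ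
      = ∫ x, φ x * ∫ ξ, planeWave ξ x * b x ξ * planeWaveTransform q ξ := by
  obtain ⟨g, hg, hbound⟩ := hb.exists_integrable_bound φ.hasCompactSupport φ.tsupport_subset q
  have hφ : Integrable φ := φ.contDiff.continuous.integrable_of_hasCompactSupport φ.hasCompactSupport
  have hc : Continuous fun p : 𝔼 d × 𝔼 d =>
      φ p.1 * b p.1 p.2 * planeWave p.2 p.1 * planeWaveTransform q p.2 :=
    ((hb.contDiff_mul φ).continuous.mul (by fun_prop)).mul
      ((continuous_planeWaveTransform q).comp continuous_snd)
  have hI : Integrable (Function.uncurry fun (x ξ : 𝔼 d) =>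
      φ x * b x ξ * planeWave ξ x * planeWaveTransform q ξ) (volume.prod volume) := by
    refine (hφ.norm.mul_prod hg).mono' hc.aestronglyMeasurable (.of_forall fun p => ?_)
    by_cases hx : p.1 ∈ tsupport φ
    · have h := hbound p.1 hx p.2
      calc _ = ‖φ p.1‖ * ‖planeWave p.2 p.1 * b p.1 p.2 * planeWaveTransform q p.2‖ := by
            rw [← norm_mul, Function.uncurry]
            ring_nf
        _ ≤ _ := by gcongr
    · simp [Function.uncurry, image_eq_zero_of_notMem_tsupport hx]
  calc _ = ∫ ξ, ∫ x, φ x * b x ξ * planeWave ξ x * planeWaveTransform q ξ := by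
        simp only [symbolPairing, mul_comm (planeWaveTransform _ _), ← integral_mul_const]
    _ = ∫ x, ∫ ξ, φ x * b x ξ * planeWave ξ x * planeWaveTransform q ξ :=
        (integral_integral_swap hI).symm
    _ = _ := by
        refine integral_congr_ae (.of_forall fun x => ?_)
        simp only [← integral_const_mul]
        refine integral_congr_ae (.of_forall fun ξ => ?_)
        simp only
        ring

/-- On test functions, the operator with symbol `b` is given by the oscillatory integral. -/
theorem HasSymbol.apply_testDist {A : compactDist Ω →ₗ[ℂ] CDistribution Ω} (hA : HasSymbol A b)
    (hb : IsSymbol Ω m b) (q : 𝓓(Ω, ℂ)) : A (testDist q) = functionDist Ω (symbolOp b q) := by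
  obtain ⟨χ, hχ⟩ := exists_testFunction_one_nhds q.hasCompactSupport q.tsupport_subset
  have hq : Distribution.IsVanishingOn (functionDist Ω q) (tsupport q)ᶜ := fun φ hφ => by
    rw [functionDist_apply (q.contDiff.continuous.locallyIntegrable.locallyIntegrableOn _)]
    refine integral_eq_zero_of_ae (.of_forall fun x => ?_)
    by_cases hx : x ∈ tsupport φ
    · simp [image_eq_zero_of_notMem_tsupport (hφ hx)]
    · simp [image_eq_zero_of_notMem_tsupport hx]
  ext φ
  rw [hA (testDist q) (tsupport q) χ q.hasCompactSupport hq hχ φ, functionDist_apply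
    ((hb.continuousOn_symbolOp q).locallyIntegrableOn Ω.isOpen.measurableSet)]
  have h1 : ∀ ξ, (testDist q : CDistribution Ω) (cutoffWave χ ξ) = planeWaveTransform q ξ :=
    functionDist_cutoffWave hχ
  simp_rw [h1]
  have h2 := hb.integral_planeWaveTransform_mul_symbolPairing q φ
  simp only [symbolPairing] at h2
  rw [h2, ← integral_const_mul]
  refine integral_congr_ae (.of_forall fun x => ?_)
  exact mul_left_comm _ _ _

end SymbolOpOnTestFunctions

/-! ### The ray operator and the conclusion -/

section RayOperator

variable {d : ℕ} {Ω : TopologicalSpace.Opens (𝔼 d)}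
  {a : 𝔼 d → Metric.sphere (0 : 𝔼 d) 1 → ℝ → ℂ}

/-- Both the transform of `q` and `(θ, t) ↦ a x θ t` are integrable and plane waves have modulus
one, so the integrals may be swapped. The integral over `ξ` is then Fourier inversion at the point
`x - tθ`. -/
theorem rayOp_eq_symbolOp
    (ha : ContinuousOn (fun p : 𝔼 d × (Metric.sphere (0 : 𝔼 d) 1 × ℝ) => a p.1 p.2.1 p.2.2)
      (Ω ×ˢ (univ ×ˢ Ici (0 : ℝ)))) {x : 𝔼 d} (hx : x ∈ Ω) {T : ℝ}
    (hT : ∀ θ t, T ≤ t → a x θ t = 0) (q : 𝓓(Ω, ℂ)) :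
    rayOp a q x = symbolOp (raySymbol a) q x := by
  set σ : Measure (Metric.sphere (0 : 𝔼 d) 1) := Measure.toSphere volume
  set ν : Measure ℝ := volume.restrict (Ioi 0)
  have hH : Integrable (fun p : Metric.sphere (0 : 𝔼 d) 1 × ℝ => a x p.1 p.2) (σ.prod ν) := by
    have h1 : σ.prod ν = (σ.prod volume).restrict (univ ×ˢ Ioi 0) := by
      rw [← Measure.prod_restrict, Measure.restrict_univ]
    rw [h1]
    change IntegrableOn _ _ _
    have h2 : IntegrableOn (fun p : Metric.sphere (0 : 𝔼 d) 1 × ℝ => a x p.1 p.2)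
        (univ ×ˢ Icc 0 T) (σ.prod volume) := by
      refine ContinuousOn.integrableOn_compact (isCompact_univ.prod isCompact_Icc) ?_
      exact ha.comp (f := fun p : Metric.sphere (0 : 𝔼 d) 1 × ℝ => (x, p)) (by fun_prop)
        fun p hp => ⟨hx, trivial, hp.2.1⟩
    refine IntegrableOn.of_forall_sdiff_eq_zero h2 (MeasurableSet.univ.prod measurableSet_Ioi)
      fun p hp => hT _ _ ?_
    by_contra h
    exact hp.2 ⟨trivial, le_of_lt hp.1.2, (not_le.1 h).le⟩
  have hq := integrable_planeWaveTransform q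
  have hr : Continuous fun p : Metric.sphere (0 : 𝔼 d) 1 × ℝ => p.2 • (p.1 : 𝔼 d) := by fun_prop
  have hsymb : ∀ ξ, raySymbol a x ξ
      = ∫ p, a x p.1 p.2 * planeWave (-ξ) (p.2 • (p.1 : 𝔼 d)) ∂(σ.prod ν) := fun ξ => by
    refine (integral_prod (fun p : Metric.sphere (0 : 𝔼 d) 1 × ℝ =>
      a x p.1 p.2 * planeWave (-ξ) (p.2 • (p.1 : 𝔼 d))) ?_).symm
    refine hH.norm.mono (hH.aestronglyMeasurable.mul
      (by fun_prop : Continuous _).aestronglyMeasurable) (.of_forall fun p => ?_)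
    simp [norm_planeWave]
  have hF : Integrable (Function.uncurry fun (ξ : 𝔼 d) (p : Metric.sphere (0 : 𝔼 d) 1 × ℝ) =>
      planeWave ξ (x - p.2 • (p.1 : 𝔼 d)) * (planeWaveTransform q ξ * a x p.1 p.2))
      (volume.prod (σ.prod ν)) := by
    have h := hq.mul_prod hH
    refine h.norm.mono (Continuous.aestronglyMeasurable (by fun_prop) |>.mul
      h.aestronglyMeasurable) (.of_forall fun p => ?_)
    simp [Function.uncurry, norm_planeWave]
  have hqx : Integrable (fun p : Metric.sphere (0 : 𝔼 d) 1 × ℝ =>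
      a x p.1 p.2 * q (x - p.2 • (p.1 : 𝔼 d))) (σ.prod ν) := by
    obtain ⟨B, hB⟩ := q.hasCompactSupport.exists_bound_of_continuous q.contDiff.continuous
    exact hH.mul_bdd (c := B) (q.contDiff.continuous.comp (by fun_prop)).aestronglyMeasurable
      (.of_forall fun p => hB _)
  have hpi : (2 * (Real.pi : ℂ)) ^ d ≠ 0 := by simp [Real.pi_ne_zero]
  symm
  calc symbolOp (raySymbol a) q x
      = ((2 * (Real.pi : ℂ)) ^ d)⁻¹ * ∫ ξ, ∫ p, planeWave ξ (x - p.2 • (p.1 : 𝔼 d)) *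
          (planeWaveTransform q ξ * a x p.1 p.2) ∂(σ.prod ν) := by
        unfold symbolOp
        congr 1
        refine integral_congr_ae (.of_forall fun ξ => ?_)
        change planeWave ξ x * raySymbol a x ξ * planeWaveTransform q ξ = _
        simp only [hsymb, ← integral_const_mul, ← integral_mul_const, planeWave_sub]
        refine integral_congr_ae (.of_forall fun p => ?_)
        simp only
        ring
    _ = ((2 * (Real.pi : ℂ)) ^ d)⁻¹ * ∫ p, (∫ ξ, planeWave ξ (x - p.2 • (p.1 : 𝔼 d)) *
          (planeWaveTransform q ξ * a x p.1 p.2)) ∂(σ.prod ν) := by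
        rw [integral_integral_swap hF]
    _ = ∫ p, a x p.1 p.2 * q (x - p.2 • (p.1 : 𝔼 d)) ∂(σ.prod ν) := by
        rw [← integral_const_mul]
        refine integral_congr_ae (.of_forall fun p => ?_)
        simp only [← mul_assoc, integral_mul_const]
        rw [integral_planeWave_mul_planeWaveTransform, inv_mul_cancel_left₀ hpi, mul_comm]
    _ = rayOp a q x := integral_prod_symm _ hqx

/-- A cutoff at times larger than the diameter of `Ω` does not change the operator. -/
theorem rayOp_congr {a' : 𝔼 d → Metric.sphere (0 : 𝔼 d) 1 → ℝ → ℂ} {R : ℝ}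
    (hR : ∀ x ∈ Ω, ∀ y ∈ Ω, dist x y ≤ R) (h : ∀ x θ t, 0 ≤ t → t ≤ R → a' x θ t = a x θ t)
    (q : 𝓓(Ω, ℂ)) {x : 𝔼 d} (hx : x ∈ Ω) : rayOp a' q x = rayOp a q x := by
  refine setIntegral_congr_fun measurableSet_Ioi fun t ht => ?_
  refine integral_congr_ae (.of_forall fun θ => ?_)
  have ht0 : 0 < t := ht
  simp only
  by_cases htR : t ≤ R
  · rw [h x θ t ht0.le htR]
  · have h0 : q (x - t • (θ : 𝔼 d)) = 0 := by
      refine image_eq_zero_of_notMem_tsupport fun hq => htR ?_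
      have h1 := hR x hx _ (q.tsupport_subset hq)
      rwa [dist_eq_norm, sub_sub_cancel, norm_smul, Real.norm_of_nonneg ht0.le,
        norm_eq_of_mem_sphere, mul_one] at h1
    rw [h0, mul_zero, mul_zero]

end RayOperator

section PseudodifferentialRayOperator

variable {n : ℕ} {Ω : TopologicalSpace.Opens (𝔼 (n + 1))}
  {a : 𝔼 (n + 1) → Metric.sphere (0 : 𝔼 (n + 1)) 1 → ℝ → ℂ}

theorem exists_hasSymbol_raySymbol
    (ha : ContMDiffOn (𝓘(ℝ, 𝔼 (n + 1)).prod ((𝓡 n).prod 𝓘(ℝ, ℝ))) 𝓘(ℝ, ℂ) ∞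
      (fun p : 𝔼 (n + 1) × (Metric.sphere (0 : 𝔼 (n + 1)) 1 × ℝ) => a p.1 p.2.1 p.2.2)
      ((Ω : Set (𝔼 (n + 1))) ×ˢ (univ ×ˢ Ici (0 : ℝ))))
    (hsupp : ∀ K : Set (𝔼 (n + 1)), IsCompact K → K ⊆ Ω →
      ∃ T : ℝ, ∀ x ∈ K, ∀ θ, ∀ t, T ≤ t → a x θ t = 0) :
    ∃ A : compactDist Ω →ₗ[ℂ] CDistribution Ω, HasSymbol A (raySymbol a) ∧
      IsSymbol Ω (-1 / 2) (raySymbol a) ∧ ∀ q : 𝓓(Ω, ℂ),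
        LocallyIntegrableOn (rayOp a q) Ω ∧ A (testDist q) = functionDist Ω (rayOp a q) ∧
        ∀ x ∈ Ω, rayOp a q x = symbolOp (raySymbol a) q x := by
  have hb := isSymbol_raySymbol ha hsupp
  obtain ⟨A, hA⟩ := hb.exists_hasSymbol
  refine ⟨A, hA, hb, fun q => ?_⟩
  have heq : ∀ x ∈ Ω, rayOp a q x = symbolOp (raySymbol a) q x := fun x hx => by
    obtain ⟨T, hT⟩ := hsupp {x} isCompact_singleton (singleton_subset_iff.2 hx)
    exact rayOp_eq_symbolOp ha.continuousOn hx (hT x rfl) q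
  have hli : LocallyIntegrableOn (symbolOp (raySymbol a) q) Ω :=
    (hb.continuousOn_symbolOp q).locallyIntegrableOn Ω.isOpen.measurableSet
  refine ⟨hli.congr ((ae_restrict_mem Ω.isOpen.measurableSet).mono fun x hx => (heq x hx).symm),
    ?_, heq⟩
  rw [hA.apply_testDist hb q]
  exact functionDist_congr hli fun x hx => (heq x hx).symm

theorem exists_smooth_cutoff_time
    (ha : ContMDiffOn (𝓘(ℝ, 𝔼 (n + 1)).prod ((𝓡 n).prod 𝓘(ℝ, ℝ))) 𝓘(ℝ, ℂ) ∞
      (fun p : 𝔼 (n + 1) × (Metric.sphere (0 : 𝔼 (n + 1)) 1 × ℝ) => a p.1 p.2.1 p.2.2)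
      ((Ω : Set (𝔼 (n + 1))) ×ˢ (univ ×ˢ Ici (0 : ℝ)))) (R : ℝ) :
    ∃ a' : 𝔼 (n + 1) → Metric.sphere (0 : 𝔼 (n + 1)) 1 → ℝ → ℂ,
      ContMDiffOn (𝓘(ℝ, 𝔼 (n + 1)).prod ((𝓡 n).prod 𝓘(ℝ, ℝ))) 𝓘(ℝ, ℂ) ∞
        (fun p : 𝔼 (n + 1) × (Metric.sphere (0 : 𝔼 (n + 1)) 1 × ℝ) => a' p.1 p.2.1 p.2.2)
        ((Ω : Set (𝔼 (n + 1))) ×ˢ (univ ×ˢ Ici (0 : ℝ))) ∧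
      (∀ x θ t, t ≤ R → a' x θ t = a x θ t) ∧ ∀ x θ t, R + 1 ≤ t → a' x θ t = 0 := by
  refine ⟨fun x θ t => Real.smoothTransition (R + 1 - t) • a x θ t, ?_, fun x θ t ht => ?_,
    fun x θ t ht => ?_⟩
  · have h1 : ContMDiff (𝓘(ℝ, 𝔼 (n + 1)).prod ((𝓡 n).prod 𝓘(ℝ, ℝ))) 𝓘(ℝ, ℝ) ∞
        fun p : 𝔼 (n + 1) × (Metric.sphere (0 : 𝔼 (n + 1)) 1 × ℝ) =>
          Real.smoothTransition (R + 1 - p.2.2) :=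
      ContMDiff.comp (I' := 𝓘(ℝ, ℝ)) (g := fun t => Real.smoothTransition (R + 1 - t))
        (Real.smoothTransition.contDiff.comp (by fun_prop)).contMDiff
        (contMDiff_snd.comp contMDiff_snd)
    exact h1.contMDiffOn.smul ha
  · simp only
    rw [Real.smoothTransition.one_of_one_le (by linarith), one_smul]
  · simp only
    rw [Real.smoothTransition.zero_of_nonpos (by linarith), zero_smul]

end PseudodifferentialRayOperator

end

theorem mainTheorem6 (n : ℕ) (hn : 1 ≤ n)
    (Ω : TopologicalSpace.Opens (EuclideanSpace ℝ (Fin (n + 1))))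
    (hconv : Convex ℝ (Ω : Set (EuclideanSpace ℝ (Fin (n + 1)))))
    (hbdd : Bornology.IsBounded (Ω : Set (EuclideanSpace ℝ (Fin (n + 1)))))
    (a : EuclideanSpace ℝ (Fin (n + 1)) →
      Metric.sphere (0 : EuclideanSpace ℝ (Fin (n + 1))) 1 → ℝ → ℂ)
    (ha : ContMDiffOn
      (𝓘(ℝ, EuclideanSpace ℝ (Fin (n + 1))).prod ((𝓡 n).prod 𝓘(ℝ, ℝ))) 𝓘(ℝ, ℂ) ∞
      (fun p : EuclideanSpace ℝ (Fin (n + 1)) ×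
        (Metric.sphere (0 : EuclideanSpace ℝ (Fin (n + 1))) 1 × ℝ) => a p.1 p.2.1 p.2.2)
      ((Ω : Set (EuclideanSpace ℝ (Fin (n + 1)))) ×ˢ (Set.univ ×ˢ Set.Ici (0 : ℝ))))
    (hsupp : ∀ x ∈ Ω, ∀ θ, ∃ T : ℝ, ∀ t, T ≤ t → a x θ t = 0) :
    ∃ A : compactDist Ω →ₗ[ℂ] CDistribution Ω,
      (∀ q : 𝓓(Ω, ℂ), MeasureTheory.LocallyIntegrableOn (rayOp a q) Ω MeasureTheory.volume ∧
        A (testDist q) = functionDist Ω (rayOp a q)) ∧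
      IsPseudodifferential (-1 / 2) A ∧
      ((∀ K : Set (EuclideanSpace ℝ (Fin (n + 1))), IsCompact K → K ⊆ Ω →
          ∃ T : ℝ, ∀ x ∈ K, ∀ θ, ∀ t, T ≤ t → a x θ t = 0) →
        IsSymbol Ω (-1 / 2) (raySymbol a) ∧ HasSymbol A (raySymbol a) ∧
        ∀ q : 𝓓(Ω, ℂ), ∀ x ∈ Ω, rayOp a q x = symbolOp (raySymbol a) q x) := by
  obtain ⟨R, hR⟩ := Metric.isBounded_iff.1 hbdd
  -- If the support is locally uniformly bounded, `A` has to have the symbol of `a` itself, so no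
  -- cutoff is made. The case distinction avoids showing that the operators for `a` and for its
  -- truncation agree on all compactly supported distributions.
  by_cases hloc : ∀ K : Set (EuclideanSpace ℝ (Fin (n + 1))), IsCompact K → K ⊆ Ω →
      ∃ T : ℝ, ∀ x ∈ K, ∀ θ, ∀ t, T ≤ t → a x θ t = 0
  · obtain ⟨A, hA, hb, h⟩ := exists_hasSymbol_raySymbol ha hloc
    exact ⟨A, fun q => ⟨(h q).1, (h q).2.1⟩, ⟨_, hb, hA⟩, fun _ => ⟨hb, hA, fun q => (h q).2.2⟩⟩
  · obtain ⟨a', ha', heq, hzero⟩ := exists_smooth_cutoff_time ha R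
    obtain ⟨A, hA, hb, h⟩ := exists_hasSymbol_raySymbol ha'
      fun K _ _ => ⟨R + 1, fun x _ θ t ht => hzero x θ t ht⟩
    refine ⟨A, fun q => ?_, ⟨_, hb, hA⟩, fun hloc' => absurd hloc' hloc⟩
    have hq : Set.EqOn (rayOp a' q) (rayOp a q) Ω := fun x hx =>
      rayOp_congr (fun x hx y hy => hR hx hy) (fun x θ t _ ht => heq x θ t ht) q hx
    refine ⟨(h q).1.congr ((MeasureTheory.ae_restrict_mem Ω.isOpen.measurableSet).mono
      fun x hx => hq hx), ?_⟩
    rw [(h q).2.1]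
    exact functionDist_congr (h q).1 hq
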